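/- Let $T$ be a bounded self-adjoint operator on a complex Hilbert space $\mathcal H$, let $a<b$ be reals in the resolvent set $\rho(T)$, put $\Delta=[a,b]$, and assume that every point of $\sigma(T)\cap\Delta$ is an isolated point of $\sigma(T)$ which is an eigenvalue of finite multiplicity. Let $\lambda_1,\dots,\lambda_d$ ($d\ge 0$) be the elements of $\sigma(T)\cap\Delta$, let $\mathcal L(\{\lambda_j\})=\ker(T-\lambda_j)$, and let $\mathcal L(\Delta)$ be the span of these eigenspaces. Let $(\mathcal L_n)$ be a sequence of finite-dimensional subspaces of $\mathcal H$ such that for every $\phi\in\mathcal H$ there are $\phi_n\in\mathcal L_n$ with $\phi_n\to\phi$. Let $P_n$ be the orthogonal projection of $\mathcal H$ onto $\mathcal L_n$, let $E_n$ be the spectral measure of the self-adjoint operator $P_nT|_{\mathcal L_n}$ on $\mathcal L_n$, and put $Q_n=E_n(\Delta)P_n$. Put $$\delta_n=\delta(\mathcal L(\Delta),\mathcal L_n)=\sup_{x\in\mathcal L(\Delta),\,\|x\|=1}\operatorname{dist}(x,\mathcal L_n)\qquad(\delta_n=0\text{ if }\mathcal L(\Delta)=\{0\}).$$ For $\tau,r\ge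 0$ let $U_{\tau,r}(a,b)$ be the set of all $z\in\mathbb C$ with $a\le\operatorname{Re}z\le b$, $0\le\operatorname{Im}z\le 1$, $|z-a|\ge 1+\tau$, $|z-b|\ge 1+\tau$, and, for $1\le j\le d$, $|z-(\lambda_j+i)|\ge r$ and $z\ne\lambda_j+i$. (The last condition matters only if $r=0$.) Then there are sequences $(\tau_n)$, $(r_n)$ of non-negative reals with $$\tau_n=\mathcal O(\delta_n)\quad\text{and}\quad r_n=\mathcal O(\delta_n^2)\qquad(n\to\infty)$$ such that for all sufficiently large $n$: 1. $U_{\tau_n,r_n}(a,b)\setminus\mathbb R\subset\rho(T+iQ_n)$. 2. If $\delta_n\ne 0$, then for each $1\le j\le d$ the circle $\Gamma_j$ with center $\lambda_j+i$ and radius $r_n$ is contained in $\rho(T+iQ_n)$, and the spectral subspace of $T+iQ_n$ associated to the region enclosed by $\Gamma_j$, i.e. the range of $-\frac1{2\pi i}\oint_{\Gamma_j}(T+iQ_n-\zeta)^{-1}\,d\zeta$, has dimension $\dim\mathcal L(\{\lambda_j\})$. 3. If $\delta_n=0$ (so that $\mathcal L(\Delta)\subset\mathcal L_n$), then for each $1\le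 j\le d$ the assertion of 2 about $\Gamma_j$ holds for the circle with center $\lambda_j+i$ and radius $\rho$ in place of $r_n$, for all sufficiently small $\rho>0$. -/

import Mathlib

open Filter Topology Asymptotics

noncomputable section

/-- The span of all eigenvectors of `A` whose eigenvalue lies in the set `J` of reals. For a
self-adjoint `A` whose spectrum in `J` consists of finitely many eigenvalues, this is the range
of the spectral projection of `A` for the set `J`. -/
def eigenspaceSpan {V : Type*} [NormedAddCommGroup V] [InnerProductSpace ℂ V]
    (A : V →L[ℂ] V) (J : Set ℝ) : Submodule ℂ V :=
  ⨆ x ∈ J, Module.End.eigenspace (A : V →ₗ[ℂ] V) (x : ℂ)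

/-- The discrete spectrum of a (self-adjoint) operator: the isolated points of the spectrum that
are eigenvalues of finite multiplicity. -/
def discreteSpectrum {H : Type*} [NormedAddCommGroup H] [InnerProductSpace ℂ H]
    (A : H →L[ℂ] H) : Set ℂ :=
  {z | z ∈ spectrum ℂ A ∧ (∀ᶠ w in 𝓝[≠] z, w ∉ spectrum ℂ A) ∧
    Module.End.HasEigenvalue (A : H →ₗ[ℂ] H) z ∧
    FiniteDimensional ℂ (Module.End.eigenspace (A : H →ₗ[ℂ] H) z)}

/-- The one-sided gap `δ(L, M) = sup {dist(x, M) : x ∈ L, ‖x‖ = 1}` (zero if `L = {0}`). -/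
def subspaceGap {H : Type*} [NormedAddCommGroup H] [InnerProductSpace ℂ H]
    (L M : Submodule ℂ H) : ℝ :=
  sSup ((fun x : H => Metric.infDist x (M : Set H)) '' {x : H | x ∈ L ∧ ‖x‖ = 1})

/-- The compression `P T|_L : L → L`, where `P` is the orthogonal projection onto `L`. -/
def galerkinCompression {H : Type*} [NormedAddCommGroup H] [InnerProductSpace ℂ H]
    (T : H →L[ℂ] H) (L : Submodule ℂ H) [FiniteDimensional ℂ L] : L →L[ℂ] L :=
  L.orthogonalProjectionOnto ∘L T ∘L L.subtypeL

/-- The projection `Q = E_L(J) P` on the whole space, where `P` is the orthogonal projection onto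
`L` and `E_L(J)` is the spectral projection for `J` of the compression `P T|_L`, a self-adjoint
operator on a finite-dimensional space if `T` is self-adjoint. -/
def galerkinProjection {H : Type*} [NormedAddCommGroup H] [InnerProductSpace ℂ H]
    (T : H →L[ℂ] H) (L : Submodule ℂ H) [FiniteDimensional ℂ L] (J : Set ℝ) : H →L[ℂ] H :=
  L.subtypeL ∘L (eigenspaceSpan (galerkinCompression T L) J).starProjection ∘L
    L.orthogonalProjectionOnto

/-- The region `U_{τ,r}(a,b)`: the points of the rectangle `[a,b] × [0,1]` outside the circles of
radius `1 + τ` about `a` and `b` and outside the circles of radius `r` about `λ + i`, for `λ` in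
`σ(T) ∩ [a,b]`. The points `λ + i` themselves are never in the region; this is automatic unless
`r = 0`. -/
def galerkinRegion {H : Type*} [NormedAddCommGroup H] [InnerProductSpace ℂ H]
    (T : H →L[ℂ] H) (a b τ r : ℝ) : Set ℂ :=
  {z | a ≤ z.re ∧ z.re ≤ b ∧ 0 ≤ z.im ∧ z.im ≤ 1 ∧
    1 + τ ≤ ‖z - (a : ℂ)‖ ∧ 1 + τ ≤ ‖z - (b : ℂ)‖ ∧
    ∀ x ∈ Set.Icc a b, (x : ℂ) ∈ spectrum ℂ T →
      r ≤ ‖z - ((x : ℂ) + Complex.I)‖ ∧ z ≠ (x : ℂ) + Complex.I}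

/-- The Riesz projection `-(2πi)⁻¹ ∮ (A - ζ)⁻¹ dζ` over the circle of centre `c` and radius `r`;
in Mathlib, `resolvent A ζ` is `(ζ - A)⁻¹`. -/
def rieszProjection {H : Type*} [NormedAddCommGroup H] [InnerProductSpace ℂ H]
    (A : H →L[ℂ] H) (c : ℂ) (r : ℝ) : H →L[ℂ] H :=
  (2 * (Real.pi : ℂ) * Complex.I)⁻¹ • ∮ ζ in C(c, r), resolvent A ζ

/-- The circle of centre `c` and radius `r` lies in the resolvent set of `A`, and the spectral
subspace of `A` associated to the enclosed region has dimension `m`. -/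
def CircleEncloses {H : Type*} [NormedAddCommGroup H] [InnerProductSpace ℂ H]
    (A : H →L[ℂ] H) (c : ℂ) (r : ℝ) (m : ℕ) : Prop :=
  Metric.sphere c r ⊆ resolventSet ℂ A ∧
    Module.finrank ℂ (LinearMap.range (rieszProjection A c r : H →ₗ[ℂ] H)) = m

end

/-! Let `E` be the spectral projection of `T` for `[a,b]`, of finite rank, and let `m`, `h` be the
midpoint and half-length of the interval. Since `a` and `b` lie outside the spectrum, `|T - m| ≤ h'
< h` on `ran E` and `|T - m| ≥ h₂ > h` on `ker E`. The second bound and a numerical range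
computation show that, on `ker E`, adding `i` times any operator between `0` and `1` cannot create
spectrum outside the discs of radius 1 about `a` and `b`, not even after compression to `ker E`
(`le_norm_add_effect`, `re_im_bound_of_region`). This is why no enlargement of these discs is
needed.

The two-sided gap also makes `(1 - Q) E` of size `O(δ)`, by a Sylvester equation argument
(`norm_one_sub_galerkinProjection_mul_le`). Decompose `T + iQ - ζ` along `ran E ⊕ ker E`. The
off-diagonal blocks are `O(δ)`; the block on `ran E` is `T + i - ζ` up to `E(1 - Q)E`, which is
`O(δ²)` because `1 - Q` is a projection. Elimination of the `ker E` component costs another `O(δ²)`,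
so `T + iQ - ζ` is bounded below once `ζ` is further than a multiple of `δ²` from every `λ + i`
(`ReducingGap.norm_le`). As `Q` has finite rank and `ζ` is not real, injectivity already puts `ζ` in
the resolvent set (`mem_resolventSet_of_injective`).

For the multiplicities, take a circle about `λ + i` of fixed radius. Deleting the off-diagonal
blocks and `E(1 - Q)E` is a small perturbation, and the operator left over has the eigenprojection
of `λ` as its exact Riesz projection. Hence the Riesz projection of `T + iQ` is within distance less
than 1 of it and has the same rank (`ReducingGap.exists_norm_rieszProjection_sub_lt`). Since the
annulus inside contains no spectrum, the circle can then be shrunk to radius of order `δ²`. -/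

/-! ### Spectral projections of a self-adjoint operator for relatively clopen sets -/

section SpectralProjection

variable {H : Type*} [NormedAddCommGroup H] [InnerProductSpace ℂ H] [CompleteSpace H]

/-- The spectral projection of `T` for the set `S`, meaningful if `S` is relatively clopen in the
spectrum of `T`. -/
noncomputable def specProj (T : H →L[ℂ] H) (S : Set ℝ) : H →L[ℂ] H :=
  cfc (S.indicator (1 : ℝ → ℝ)) T

/-- `S` is relatively clopen in the spectrum of `T`. -/
def SpecClopen (T : H →L[ℂ] H) (S : Set ℝ) : Prop :=
  ContinuousOn (S.indicator (1 : ℝ → ℝ)) (spectrum ℝ T)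

theorem norm_cfc_apply_sq (T : H →L[ℂ] H) {f : ℝ → ℝ} (hf : ContinuousOn f (spectrum ℝ T))
    (x : H) : ‖cfc f T x‖ ^ 2 = RCLike.re (inner ℂ (cfc (fun t => f t * f t) T x) x) := by
  have h : IsSelfAdjoint (cfc f T) := cfc_predicate f T
  rw [cfc_mul f f T hf hf, mul_apply_eq_comp]
  have := h.isSymmetric (cfc f T x) x
  simp only [ContinuousLinearMap.coe_coe] at this
  rw [this, inner_self_eq_norm_sq]

/-- A pointwise inequality on the spectrum becomes an operator inequality for the squares. The
constant `c` may be negative, which is what later allows a complex `ζ`. If `T` is not self-adjoint,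
both sides vanish by the default value of `cfc`. -/
theorem mul_norm_cfc_apply_sq_le (T : H →L[ℂ] H) {f g : ℝ → ℝ} {c : ℝ}
    (hf : ContinuousOn f (spectrum ℝ T)) (hg : ContinuousOn g (spectrum ℝ T))
    (hfg : ∀ t ∈ spectrum ℝ T, c * f t ^ 2 ≤ g t ^ 2) (x : H) :
    c * ‖cfc f T x‖ ^ 2 ≤ ‖cfc g T x‖ ^ 2 := by
  rw [norm_cfc_apply_sq T hf, norm_cfc_apply_sq T hg]
  by_cases hT : IsSelfAdjoint T
  · have h0 : (0 : H →L[ℂ] H) ≤ cfc (fun t => g t * g t - c * (f t * f t)) T :=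
      cfc_nonneg fun t ht => by have := hfg t ht; nlinarith
    rw [cfc_sub (fun t => g t * g t) (fun t => c * (f t * f t)) T (hg.mul hg)
      (continuousOn_const.mul (hf.mul hf)), cfc_const_mul c (fun t => f t * f t) T (hf.mul hf),
      ContinuousLinearMap.nonneg_iff_isPositive] at h0
    have := h0.2 x
    rw [ContinuousLinearMap.reApplyInnerSelf_apply, sub_apply,
      inner_sub_left, map_sub, smul_apply,
      RCLike.real_smul_eq_coe_smul (K := ℂ), inner_smul_left] at this
    simp at this ⊢
    linarith
  · simp [cfc_apply_of_not_predicate T hT]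

variable {T : H →L[ℂ] H}

theorem isSelfAdjoint_specProj (T : H →L[ℂ] H) (S : Set ℝ) : IsSelfAdjoint (specProj T S) :=
  cfc_predicate _ T

theorem specProj_mul_self {S : Set ℝ} (hS : SpecClopen T S) :
    specProj T S * specProj T S = specProj T S := by
  unfold specProj
  rw [← cfc_mul _ _ T hS hS]
  congr 1
  ext t
  by_cases ht : t ∈ S <;> simp [ht]

omit [CompleteSpace H] in
theorem SpecClopen.compl {S : Set ℝ} (hS : SpecClopen T S) : SpecClopen T Sᶜ := by
  have : Sᶜ.indicator (1 : ℝ → ℝ) = fun t => 1 - S.indicator (1 : ℝ → ℝ) t := by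
    ext t
    by_cases ht : t ∈ S <;> simp [ht]
  unfold SpecClopen
  rw [this]
  exact continuousOn_const.sub hS

omit [CompleteSpace H] in
theorem SpecClopen.diff {S R : Set ℝ} (hS : SpecClopen T S) (hR : SpecClopen T R) :
    SpecClopen T (S \ R) := by
  have : (S \ R).indicator (1 : ℝ → ℝ) = fun t =>
      S.indicator (1 : ℝ → ℝ) t * Rᶜ.indicator (1 : ℝ → ℝ) t := by
    ext t
    by_cases ht : t ∈ S <;> by_cases ht' : t ∈ R <;> simp [ht, ht']
  unfold SpecClopen
  rw [this]
  exact ContinuousOn.mul hS hR.compl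

theorem specProj_compl (hT : IsSelfAdjoint T) {S : Set ℝ} (hS : SpecClopen T S) :
    specProj T Sᶜ = 1 - specProj T S := by
  unfold specProj
  have : Sᶜ.indicator (1 : ℝ → ℝ) = fun t => 1 - S.indicator (1 : ℝ → ℝ) t := by
    ext t
    by_cases ht : t ∈ S <;> simp [ht]
  rw [this, cfc_sub (fun _ => 1) _ T continuousOn_const hS, cfc_const_one ℝ T]

theorem specProj_diff {S R : Set ℝ} (hS : SpecClopen T S) (hR : SpecClopen T R) (hRS : R ⊆ S) :
    specProj T (S \ R) = specProj T S - specProj T R := by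
  unfold specProj
  rw [← cfc_sub _ _ T hS hR]
  congr 1
  ext t
  by_cases ht' : t ∈ R
  · simp [ht', hRS ht']
  · by_cases ht : t ∈ S <;> simp [ht, ht']

theorem specProj_mul_of_subset {S R : Set ℝ} (hS : SpecClopen T S) (hR : SpecClopen T R)
    (hRS : R ⊆ S) : specProj T S * specProj T R = specProj T R := by
  unfold specProj
  rw [← cfc_mul _ _ T hS hR]
  congr 1
  ext t
  by_cases ht' : t ∈ R
  · simp [ht', hRS ht']
  · simp [ht']

theorem specProj_mul_of_superset {S R : Set ℝ} (hS : SpecClopen T S) (hR : SpecClopen T R)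
    (hRS : R ⊆ S) : specProj T R * specProj T S = specProj T R := by
  unfold specProj
  rw [← cfc_mul _ _ T hR hS]
  congr 1
  ext t
  by_cases ht' : t ∈ R
  · simp [ht', hRS ht']
  · simp [ht']

theorem specProj_commute (hT : IsSelfAdjoint T) (S : Set ℝ) : Commute (specProj T S) T := by
  have := cfc_commute_cfc (S.indicator (1 : ℝ → ℝ)) id T
  rwa [cfc_id ℝ T] at this

theorem cfc_sub_const_mul_indicator (hT : IsSelfAdjoint T) {S : Set ℝ} (hS : SpecClopen T S)
    (u : ℝ) (x : H) :
    cfc (fun t => (t - u) * S.indicator (1 : ℝ → ℝ) t) T x =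
      T (specProj T S x) - (u : ℂ) • specProj T S x := by
  rw [cfc_mul (fun t => t - u) _ T (by fun_prop) hS, cfc_sub (fun t => t) (fun _ => u) T,
    cfc_id' ℝ T, cfc_const u T, mul_apply_eq_comp, sub_apply,
    Algebra.algebraMap_eq_smul_one, smul_apply,
    one_apply_eq_self, RCLike.real_smul_eq_coe_smul (K := ℂ)]
  rfl

/-- Pythagoras: the cross term is the real part of `i` times a real number. -/
theorem norm_sub_smul_sq (hT : IsSelfAdjoint T) (ζ : ℂ) (x : H) :
    ‖T x - ζ • x‖ ^ 2 = ‖T x - (ζ.re : ℂ) • x‖ ^ 2 + ζ.im ^ 2 * ‖x‖ ^ 2 := by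
  have h1 : T x - ζ • x = (T x - (ζ.re : ℂ) • x) - (ζ.im * Complex.I) • x := by
    conv_lhs => rw [← Complex.re_add_im ζ]
    rw [add_smul]; abel
  have h2 : (inner ℂ (T x - (ζ.re : ℂ) • x) x).im = 0 := by
    rw [inner_sub_left, inner_smul_left, Complex.sub_im]
    have h3 := hT.isSymmetric.im_inner_apply_self x
    simp only [ContinuousLinearMap.coe_coe] at h3
    have h4 : (inner ℂ x x : ℂ).im = 0 := inner_self_im (𝕜 := ℂ) x
    have h3' : (inner ℂ (T x) x : ℂ).im = 0 := h3
    rw [h3', Complex.conj_ofReal, Complex.im_ofReal_mul, h4, mul_zero, sub_zero]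
  have h5 : RCLike.re (ζ.im * Complex.I * inner ℂ (T x - (ζ.re : ℂ) • x) x : ℂ) = 0 := by
    rw [RCLike.re_eq_complex_re, mul_assoc, Complex.re_ofReal_mul, Complex.I_mul_re, h2]
    simp
  rw [h1, @norm_sub_sq ℂ, inner_smul_right, norm_smul, h5]
  simp [mul_pow]

theorem le_norm_sub_smul_specProj (hT : IsSelfAdjoint T) {S : Set ℝ} (hS : SpecClopen T S)
    {ζ : ℂ} {D : ℝ} (hD : 0 ≤ D) (h : ∀ t ∈ spectrum ℝ T, t ∈ S → D ≤ ‖(t : ℂ) - ζ‖) (x : H) :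
    D * ‖specProj T S x‖ ≤ ‖T (specProj T S x) - ζ • specProj T S x‖ := by
  -- The functional calculus is real, so only the distance to `ζ.re` is estimated there; the
  -- contribution of `ζ.im` is restored by `norm_sub_smul_sq`.
  have key := mul_norm_cfc_apply_sq_le T (f := S.indicator (1 : ℝ → ℝ))
    (g := fun t => (t - ζ.re) * S.indicator (1 : ℝ → ℝ) t) (c := D ^ 2 - ζ.im ^ 2) hS
    (ContinuousOn.mul (by fun_prop) hS) (fun t ht => by
      by_cases hts : t ∈ S
      · have := pow_le_pow_left₀ hD (h t ht hts) 2
        rw [← Complex.normSq_eq_norm_sq, Complex.normSq_apply] at this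
        simp [hts] at this ⊢
        linarith
      · simp [hts]) x
  rw [cfc_sub_const_mul_indicator hT hS] at key
  refine le_of_sq_le_sq ?_ (norm_nonneg _)
  rw [norm_sub_smul_sq hT, mul_pow]
  have : (D ^ 2 - ζ.im ^ 2) * ‖specProj T S x‖ ^ 2 ≤ _ := key
  linarith

theorem norm_sub_smul_specProj_le (hT : IsSelfAdjoint T) {S : Set ℝ} (hS : SpecClopen T S)
    {u D : ℝ} (hD : 0 ≤ D) (h : ∀ t ∈ spectrum ℝ T, t ∈ S → |t - u| ≤ D) (x : H) :
    ‖T (specProj T S x) - (u : ℂ) • specProj T S x‖ ≤ D * ‖specProj T S x‖ := by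
  have key := mul_norm_cfc_apply_sq_le T
    (f := fun t => (t - u) * S.indicator (1 : ℝ → ℝ) t)
    (g := fun t => D * S.indicator (1 : ℝ → ℝ) t) (c := 1)
    (ContinuousOn.mul (by fun_prop) hS) (ContinuousOn.mul (by fun_prop) hS) (fun t ht => by
      by_cases hts : t ∈ S
      · simpa [hts] using sq_le_sq' (abs_le.1 (h t ht hts)).1 (abs_le.1 (h t ht hts)).2
      · simp [hts]) x
  rw [cfc_sub_const_mul_indicator hT hS, cfc_const_mul D _ T hS, one_mul,
    smul_apply, norm_smul, Real.norm_of_nonneg hD] at key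
  exact le_of_sq_le_sq key (by positivity)

end SpectralProjection

/-! ### Isolated eigenvalues: spectral projections and spans of eigenspaces -/

section EigenspaceSpan

variable {H : Type*} [NormedAddCommGroup H] [InnerProductSpace ℂ H]

theorem specClopen_singleton_of_eventually {T : H →L[ℂ] H} {x : ℝ}
    (h : ∀ᶠ t in 𝓝[≠] x, t ∉ spectrum ℝ T) : SpecClopen T {x} := by
  intro t _
  by_cases htx : t = x
  · subst htx
    refine (continuousWithinAt_const (b := (1 : ℝ))).congr_of_eventuallyEq ?_ (by simp)
    rw [eventually_nhdsWithin_iff] at h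
    filter_upwards [nhdsWithin_le_nhds h, self_mem_nhdsWithin] with s hs hsT
    have : s = t := by
      by_contra hne
      exact hs hne hsT
    simp [this]
  · refine ContinuousAt.continuousWithinAt ?_
    refine (continuousAt_const (y := (0 : ℝ))).congr ?_
    filter_upwards [isOpen_ne.mem_nhds htx] with s hs
    simp [hs]

variable [CompleteSpace H] {T : H →L[ℂ] H}

omit [CompleteSpace H] in
theorem ofReal_mem_spectrum_iff (T : H →L[ℂ] H) (x : ℝ) :
    (x : ℂ) ∈ spectrum ℂ T ↔ x ∈ spectrum ℝ T := by
  rw [← spectrum.algebraMap_mem_iff ℂ (R := ℝ)]; rfl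

theorem specClopen_singleton_of_mem_discreteSpectrum {x : ℝ}
    (h : (x : ℂ) ∈ spectrum ℂ T → (x : ℂ) ∈ discreteSpectrum T) : SpecClopen T {x} := by
  by_cases hx : x ∈ spectrum ℝ T
  · refine specClopen_singleton_of_eventually ?_
    have h1 := (h ((ofReal_mem_spectrum_iff T x).2 hx)).2.1
    have h2 : Tendsto (fun t : ℝ => (t : ℂ)) (𝓝[≠] x) (𝓝[≠] (x : ℂ)) := by
      refine tendsto_nhdsWithin_iff.2
        ⟨(Complex.continuous_ofReal.tendsto x).mono_left nhdsWithin_le_nhds, ?_⟩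
      filter_upwards [self_mem_nhdsWithin] with t ht
      simpa using ht
    filter_upwards [h2.eventually h1] with t ht
    rwa [← ofReal_mem_spectrum_iff]
  · refine specClopen_singleton_of_eventually (nhdsWithin_le_nhds ?_)
    exact (spectrum.isClosed (𝕜 := ℝ) T).isOpen_compl.mem_nhds hx

theorem SpecClopen.exists_gap {x : ℝ} (h : SpecClopen T {x}) :
    ∃ D > 0, ∀ t ∈ spectrum ℝ T, t ≠ x → D ≤ |t - x| := by
  have h1 : ∀ᶠ t in 𝓝 x, t ∈ spectrum ℝ T → t = x := by
    by_cases hx : x ∈ spectrum ℝ T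
    · have h2 := (h x hx).eventually (lt_mem_nhds (show (0 : ℝ) < Set.indicator {x} 1 x by simp))
      filter_upwards [eventually_nhdsWithin_iff.1 h2] with t ht htT
      by_contra hne
      have := ht htT
      simp [hne] at this
    · filter_upwards [(spectrum.isClosed (𝕜 := ℝ) T).isOpen_compl.mem_nhds hx] with t ht htT
      exact absurd htT ht
  obtain ⟨D, hD, h3⟩ := Metric.eventually_nhds_iff.1 h1
  refine ⟨D, hD, fun t ht hne => ?_⟩
  by_contra hlt
  exact hne (h3 (by rwa [Real.dist_eq, ← not_le]) ht)

theorem apply_specProj_singleton (hT : IsSelfAdjoint T) {x : ℝ} (h : SpecClopen T {x}) (v : H) :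
    T (specProj T {x} v) = (x : ℂ) • specProj T {x} v := by
  have := norm_sub_smul_specProj_le hT h (u := x) le_rfl
    (fun t _ ht => by simp [Set.mem_singleton_iff.1 ht]) v
  rw [zero_mul, norm_le_zero_iff, sub_eq_zero] at this
  exact this

/-- On the complementary spectral subspace `T - x` is bounded below by the gap at `x`, so an
eigenvector for `x` has no component there. -/
theorem range_specProj_singleton (hT : IsSelfAdjoint T) {x : ℝ} (h : SpecClopen T {x}) :
    LinearMap.range (specProj T {x} : H →ₗ[ℂ] H) =
      Module.End.eigenspace (T : H →ₗ[ℂ] H) (x : ℂ) := by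
  ext v
  rw [Module.End.mem_eigenspace_iff]
  constructor
  · rintro ⟨w, rfl⟩
    exact apply_specProj_singleton hT h w
  · intro hv
    obtain ⟨D, hD, hgap⟩ := h.exists_gap
    have h1 := le_norm_sub_smul_specProj hT h.compl (ζ := x) hD.le (fun t ht hts => by
      have := hgap t ht hts
      rwa [← Complex.ofReal_sub, Complex.norm_real, Real.norm_eq_abs]) v
    have h2 : T (specProj T {x}ᶜ v) = (x : ℂ) • specProj T {x}ᶜ v := by
      have h3 := congrArg (fun A : H →L[ℂ] H => A v) (specProj_commute hT {x}ᶜ).eq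
      simp only [mul_apply_eq_comp] at h3
      rw [← h3]
      have hv' : T v = (x : ℂ) • v := hv
      rw [hv', map_smul]
    rw [h2, sub_self, norm_zero] at h1
    have h4 : specProj T {x}ᶜ v = 0 := by
      rw [← norm_le_zero_iff]
      by_contra hlt
      nlinarith
    rw [specProj_compl hT h, sub_apply, one_apply_eq_self, sub_eq_zero] at h4
    exact ⟨v, h4.symm⟩

variable {J : Set ℝ}

omit [CompleteSpace H] in
theorem eqOn_indicator_sum (hfin : (spectrum ℝ T ∩ J).Finite) :
    Set.EqOn (J.indicator (1 : ℝ → ℝ))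
      (∑ x ∈ hfin.toFinset, Set.indicator {x} (1 : ℝ → ℝ)) (spectrum ℝ T) := by
  intro t ht
  rw [Finset.sum_apply]
  by_cases htJ : t ∈ J
  · rw [Finset.sum_eq_single t]
    · simp [htJ]
    · intro y _ hy
      simp [hy.symm]
    · intro h
      simp [ht, htJ] at h
  · rw [Finset.sum_eq_zero]
    · simp [htJ]
    · intro y hy
      have : t ≠ y := by
        rintro rfl
        simp [htJ] at hy
      simp [this]

omit [CompleteSpace H] in
theorem specClopen_of_finite (hfin : (spectrum ℝ T ∩ J).Finite)
    (hJ : ∀ x ∈ J, SpecClopen T {x}) : SpecClopen T J := by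
  refine ContinuousOn.congr ?_ (eqOn_indicator_sum hfin)
  have : ContinuousOn (fun t => ∑ x ∈ hfin.toFinset, Set.indicator {x} (1 : ℝ → ℝ) t)
      (spectrum ℝ T) :=
    continuousOn_finsetSum _ fun x hx => hJ x (by simpa using ((hfin.mem_toFinset).1 hx).2)
  refine this.congr fun t _ => ?_
  rw [Finset.sum_apply]

theorem specProj_eq_sum (hfin : (spectrum ℝ T ∩ J).Finite)
    (hJ : ∀ x ∈ J, SpecClopen T {x}) :
    specProj T J = ∑ x ∈ hfin.toFinset, specProj T {x} := by
  unfold specProj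
  rw [cfc_congr (eqOn_indicator_sum hfin)]
  exact cfc_sum _ T _ fun x hx => hJ x (((hfin.mem_toFinset).1 hx).2)

theorem range_specProj (hT : IsSelfAdjoint T) (hfin : (spectrum ℝ T ∩ J).Finite)
    (hJ : ∀ x ∈ J, SpecClopen T {x}) :
    LinearMap.range (specProj T J : H →ₗ[ℂ] H) = eigenspaceSpan T J := by
  apply le_antisymm
  · rintro _ ⟨w, rfl⟩
    rw [specProj_eq_sum hfin hJ]
    simp only [ContinuousLinearMap.coe_coe, sum_apply]
    refine Submodule.sum_mem _ fun x hx => ?_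
    have hxJ := ((hfin.mem_toFinset).1 hx).2
    refine (le_iSup₂_of_le x hxJ le_rfl : _ ≤ eigenspaceSpan T J) ?_
    rw [← range_specProj_singleton hT (hJ x hxJ)]
    exact ⟨w, rfl⟩
  · refine iSup₂_le fun x hx => ?_
    rw [← range_specProj_singleton hT (hJ x hx)]
    rintro _ ⟨w, rfl⟩
    refine ⟨specProj T {x} w, ?_⟩
    have := specProj_mul_of_subset (specClopen_of_finite hfin hJ) (hJ x hx)
      (Set.singleton_subset_iff.2 hx)
    exact congrArg (fun A : H →L[ℂ] H => A w) this

theorem finiteDimensional_range_specProj (hT : IsSelfAdjoint T)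
    (hfin : (spectrum ℝ T ∩ J).Finite) (hJ : ∀ x ∈ J, SpecClopen T {x})
    (hd : ∀ x ∈ J, x ∈ spectrum ℝ T →
      FiniteDimensional ℂ (Module.End.eigenspace (T : H →ₗ[ℂ] H) (x : ℂ))) :
    FiniteDimensional ℂ (LinearMap.range (specProj T J : H →ₗ[ℂ] H)) := by
  have : ∀ x : hfin.toFinset, FiniteDimensional ℂ
      (Module.End.eigenspace (T : H →ₗ[ℂ] H) ((x : ℝ) : ℂ)) := fun x =>
    hd x ((hfin.mem_toFinset).1 x.2).2 ((hfin.mem_toFinset).1 x.2).1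
  have h2 : FiniteDimensional ℂ (⨆ x : hfin.toFinset,
      Module.End.eigenspace (T : H →ₗ[ℂ] H) ((x : ℝ) : ℂ) : Submodule ℂ H) :=
    Submodule.finiteDimensional_iSup _
  refine Submodule.finiteDimensional_of_le (S₂ := ⨆ x : hfin.toFinset,
      Module.End.eigenspace (T : H →ₗ[ℂ] H) ((x : ℝ) : ℂ)) ?_
  rintro _ ⟨w, rfl⟩
  rw [specProj_eq_sum hfin hJ]
  simp only [ContinuousLinearMap.coe_coe, sum_apply]
  refine Submodule.sum_mem _ fun x hx => ?_
  refine Submodule.mem_iSup_of_mem (⟨x, hx⟩ : hfin.toFinset) ?_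
  rw [← range_specProj_singleton hT (hJ x ((hfin.mem_toFinset).1 hx).2)]
  exact ⟨w, rfl⟩

theorem starProjection_eq_of_range {E : H →L[ℂ] H} (hE : IsSelfAdjoint E) (hE2 : E * E = E)
    {M : Submodule ℂ H} [M.HasOrthogonalProjection]
    (hM : LinearMap.range (E : H →ₗ[ℂ] H) = M) : M.starProjection = E := by
  ext v
  refine Submodule.eq_starProjection_of_mem_orthogonal (hM ▸ ⟨v, rfl⟩) ?_
  rw [Submodule.mem_orthogonal]
  intro u hu
  rw [← hM] at hu
  obtain ⟨w, rfl⟩ := hu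
  have h1 : inner ℂ (E w) (v - E v) = inner ℂ w (E (v - E v)) := hE.isSymmetric w (v - E v)
  have h2 : E (E v) = E v := congrArg (fun A : H →L[ℂ] H => A v) hE2
  rw [ContinuousLinearMap.coe_coe, h1, map_sub, h2, sub_self, inner_zero_right]

/-- An infinite set would accumulate, by compactness, at a point of the interval, against the gap
there. -/
theorem finite_spectrum_inter_Icc {a b : ℝ} (hJ : ∀ x ∈ Set.Icc a b, SpecClopen T {x}) :
    (spectrum ℝ T ∩ Set.Icc a b).Finite := by
  by_contra hinf
  obtain ⟨x, hx, hacc⟩ := Set.Infinite.exists_accPt_of_subset_isCompact hinf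
    (isCompact_Icc.inter_left (spectrum.isClosed T)) subset_rfl
  obtain ⟨D, hD, hgap⟩ := (hJ x hx.2).exists_gap
  rw [accPt_iff_nhds] at hacc
  obtain ⟨y, hy, hyx⟩ := hacc (Metric.ball x D) (Metric.ball_mem_nhds x hD)
  have := hgap y hy.2.1 hyx
  have hlt := hy.1
  rw [Metric.mem_ball, Real.dist_eq] at hlt
  linarith

theorem finite_spectrum_of_finiteDimensional [FiniteDimensional ℂ H] (T : H →L[ℂ] H) :
    (spectrum ℝ T).Finite := by
  have h2 : (spectrum ℂ T).Finite := by
    have h3 := Module.End.finite_spectrum (T : H →ₗ[ℂ] H)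
    refine h3.subset fun z hz hz' => hz ?_
    rw [spectrum.mem_resolventSet_iff] at hz' ⊢
    have : IsUnit (algebraMap ℂ (H →L[ℂ] H) z - T) := by
      rw [ContinuousLinearMap.isUnit_iff_bijective]
      exact (Module.End.isUnit_iff _).1 hz'
    exact this
  refine (h2.preimage (f := fun x : ℝ => (x : ℂ)) Complex.ofReal_injective.injOn).subset ?_
  intro x hx
  exact (ofReal_mem_spectrum_iff T x).2 hx

/-- This makes the same spectral projections available for the Galerkin compressions, with no
condition on the set. -/
theorem specClopen_of_finiteDimensional [FiniteDimensional ℂ H] (T : H →L[ℂ] H) (S : Set ℝ) :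
    SpecClopen T S := by
  have := (finite_spectrum_of_finiteDimensional T).to_subtype
  unfold SpecClopen
  rw [continuousOn_iff_continuous_domRestrict]
  exact continuous_of_discreteTopology

end EigenspaceSpan

/-! ### Lower bounds for `T + iQ - ζ` and finite rank perturbations -/

section GapEstimates

variable {H : Type*} [NormedAddCommGroup H] [InnerProductSpace ℂ H]

variable [CompleteSpace H]

/-- A self-adjoint operator `Q` with `Q² ≤ Q`, that is `0 ≤ Q ≤ 1`. -/
structure IsEffect (Q : H →L[ℂ] H) : Prop where
  isSelfAdjoint : IsSelfAdjoint Q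
  norm_sq_le : ∀ x, ‖Q x‖ ^ 2 ≤ (inner ℂ (Q x) x : ℂ).re

theorem norm_apply_sq_of_projection {E : H →L[ℂ] H} (hE : IsSelfAdjoint E) (hE2 : E * E = E)
    (x : H) : ‖E x‖ ^ 2 = (inner ℂ (E x) x : ℂ).re := by
  have h1 : inner ℂ (E (E x)) x = inner ℂ (E x) (E x) := hE.isSymmetric (E x) x
  have h2 : E (E x) = E x := congrArg (fun A : H →L[ℂ] H => A x) hE2
  rw [h2] at h1
  rw [h1]
  exact (inner_self_eq_norm_sq (𝕜 := ℂ) (E x)).symm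

theorem isEffect_of_projection {E : H →L[ℂ] H} (hE : IsSelfAdjoint E) (hE2 : E * E = E) :
    IsEffect E :=
  ⟨hE, fun x => (norm_apply_sq_of_projection hE hE2 x).le⟩

theorem IsEffect.norm_apply_le {Q : H →L[ℂ] H} (hQ : IsEffect Q) (x : H) : ‖Q x‖ ≤ ‖x‖ := by
  have h1 := (hQ.norm_sq_le x).trans (Complex.re_le_norm _)
  have h2 := h1.trans (norm_inner_le_norm (𝕜 := ℂ) (Q x) x)
  by_contra hlt
  push Not at hlt
  nlinarith [norm_nonneg x, norm_nonneg (Q x)]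

theorem IsEffect.norm_le_one {Q : H →L[ℂ] H} (hQ : IsEffect Q) : ‖Q‖ ≤ 1 :=
  Q.opNorm_le_bound zero_le_one fun x => by simpa using hQ.norm_apply_le x

/-- The compression of a projection is in general no projection but stays between `0` and `1`; this
is why the bounds on `ker E` are proved for effects. -/
theorem IsEffect.compress {Q F : H →L[ℂ] H} (hQ : IsEffect Q) (hF : IsSelfAdjoint F)
    (hF2 : F * F = F) : IsEffect (F * Q * F) := by
  refine ⟨?_, fun x => ?_⟩
  · rw [IsSelfAdjoint, star_mul, star_mul, hF.star_eq, hQ.isSelfAdjoint.star_eq, mul_assoc]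
  · have h1 : inner ℂ (F (Q (F x))) x = inner ℂ (Q (F x)) (F x) := hF.isSymmetric _ x
    have h2 := (isEffect_of_projection hF hF2).norm_apply_le (Q (F x))
    have h3 := hQ.norm_sq_le (F x)
    simp only [mul_apply_eq_comp]
    rw [h1]
    exact (pow_le_pow_left₀ (norm_nonneg _) h2 2).trans h3

/-- The basic lower bound: `T` is bounded below by `h₂` about `m` on `w`, and `ζ` satisfies
`(Re ζ - m)² + Im ζ - (Im ζ)² ≤ h²` with `h < h₂`. -/
theorem le_norm_add_effect {T Q : H →L[ℂ] H} (hT : IsSelfAdjoint T) (hQ : IsEffect Q)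
    {m h h₂ : ℝ} (hh : 0 ≤ h) (hh₂ : h < h₂) {w : H} (hw : h₂ * ‖w‖ ≤ ‖T w - (m : ℂ) • w‖)
    {ζ : ℂ} (hζ : (ζ.re - m) ^ 2 + ζ.im - ζ.im ^ 2 ≤ h ^ 2) (hy : |ζ.im| ≤ 2) :
    (h₂ ^ 2 - h ^ 2) / (2 * h₂ + 5) * ‖w‖ ≤ ‖T w + Complex.I • Q w - ζ • w‖ := by
  set e := T w + Complex.I • Q w - ζ • w with he
  set s := (inner ℂ (Q w) w : ℂ).re with hs
  have hQw : (inner ℂ (Q w) w : ℂ) = s := by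
    apply Complex.ext
    · simp [hs]
    · have := hQ.isSelfAdjoint.isSymmetric.im_inner_apply_self w
      rw [Complex.ofReal_im]
      exact this
  have hQw' : (inner ℂ w (Q w) : ℂ) = s := by
    rw [← hQw]; exact (hQ.isSelfAdjoint.isSymmetric w w).symm
  have hTw : (inner ℂ (T w) w : ℂ).im = 0 := hT.isSymmetric.im_inner_apply_self w
  have hww : (inner ℂ w w : ℂ) = ((‖w‖ ^ 2 : ℝ) : ℂ) := by
    rw [inner_self_eq_norm_sq_to_K]; simp
  have him : (inner ℂ e w : ℂ).im = ζ.im * ‖w‖ ^ 2 - s := by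
    rw [he, inner_sub_left, inner_add_left, inner_smul_left, inner_smul_left, hQw, hww,
      Complex.sub_im, Complex.add_im, hTw]
    simp [-Complex.ofReal_pow]
    ring
  have h1 : |ζ.im * ‖w‖ ^ 2 - s| ≤ ‖e‖ * ‖w‖ := by
    rw [← him]
    exact (Complex.abs_im_le_norm _).trans (norm_inner_le_norm _ _)
  -- `(T - m) w` is `e` plus the vector measured by `X`. Its square contains `-2 (Im ζ) s + ‖Q w‖²`,
  -- at most `s (1 - 2 Im ζ)`, and `h1` says that `s` is `(Im ζ) ‖w‖²` up to `‖e‖ ‖w‖`. Substituting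
  -- produces exactly the expression in `hζ`; the factor 5 bounds `|1 - 2 Im ζ|`.
  set X := ‖(ζ - m) • w - Complex.I • Q w‖ with hX
  have h2 : X ^ 2 = ((ζ.re - m) ^ 2 + ζ.im ^ 2) * ‖w‖ ^ 2 - 2 * (ζ.im * s) + ‖Q w‖ ^ 2 := by
    have h3 : RCLike.re (inner ℂ ((ζ - m) • w) (Complex.I • Q w) : ℂ) = ζ.im * s := by
      rw [inner_smul_left, inner_smul_right, hQw', RCLike.re_eq_complex_re]
      simp
    rw [hX, @norm_sub_sq ℂ, h3, norm_smul, norm_smul, mul_pow, mul_pow,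
      ← Complex.normSq_eq_norm_sq, Complex.normSq_apply, Complex.norm_I, Complex.sub_re,
      Complex.sub_im, Complex.ofReal_re, Complex.ofReal_im]
    ring
  have h4 : X ^ 2 ≤ h ^ 2 * ‖w‖ ^ 2 + 5 * (‖e‖ * ‖w‖) := by
    have h5 := hQ.norm_sq_le w
    have h6 : (s - ζ.im * ‖w‖ ^ 2) * (1 - 2 * ζ.im) ≤ (‖e‖ * ‖w‖) * 5 := by
      refine (le_abs_self _).trans ?_
      rw [abs_mul, abs_sub_comm s]
      refine mul_le_mul h1 ?_ (abs_nonneg _) (by positivity)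
      rw [abs_le] at hy ⊢
      constructor <;> linarith [hy.1, hy.2]
    have h7 := mul_le_mul_of_nonneg_right hζ (sq_nonneg ‖w‖)
    rw [h2]
    linarith
  have h8 : h₂ * ‖w‖ ≤ ‖e‖ + X := by
    refine hw.trans ?_
    have : T w - (m : ℂ) • w = e + ((ζ - m) • w - Complex.I • Q w) := by
      rw [he, sub_smul]; abel
    rw [this]
    exact norm_add_le _ _
  have hpos : 0 < 2 * h₂ + 5 := by linarith
  rw [div_mul_eq_mul_div, div_le_iff₀ hpos]
  rcases (norm_nonneg w).eq_or_lt with h0 | h0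
  · rw [← h0, mul_zero]; positivity
  have h9 := norm_nonneg e
  -- Squaring `h₂‖w‖ - ‖e‖ ≤ X` needs a nonnegative left side; in the other case `e` is already
  -- large enough.
  rcases le_total (h₂ * ‖w‖) ‖e‖ with hle | hle
  · have h10 : h₂ ^ 2 * ‖w‖ ≤ h₂ * ‖e‖ := by nlinarith
    have h11 : 0 ≤ h ^ 2 * ‖w‖ := by positivity
    have h12 : 0 ≤ h₂ * ‖e‖ := mul_nonneg (by linarith) h9
    nlinarith
  · have h10 : (h₂ * ‖w‖ - ‖e‖) ^ 2 ≤ X ^ 2 :=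
      pow_le_pow_left₀ (by linarith) (by linarith) 2
    have h11 : ((h₂ ^ 2 - h ^ 2) * ‖w‖) * ‖w‖ ≤ (‖e‖ * (2 * h₂ + 5)) * ‖w‖ := by nlinarith
    exact le_of_mul_le_mul_right h11 h0

/-- `E` is a projection that reduces `T`, and on its kernel `T` is bounded below by `h₂ > h`
about `m`. -/
structure ReducingGap (T E : H →L[ℂ] H) (m h h₂ : ℝ) : Prop where
  isSelfAdjoint : IsSelfAdjoint T
  isSelfAdjoint_proj : IsSelfAdjoint E
  proj_mul_self : E * E = E
  commute : Commute E T
  nonneg : 0 ≤ h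
  lt : h < h₂
  gap : ∀ x, h₂ * ‖x - E x‖ ≤ ‖T (x - E x) - (m : ℂ) • (x - E x)‖

namespace ReducingGap

variable {T E : H →L[ℂ] H} {m h h₂ : ℝ} (G : ReducingGap T E m h h₂)
include G

theorem apply_apply (x : H) : E (E x) = E x :=
  congrArg (fun A : H →L[ℂ] H => A x) G.proj_mul_self

theorem apply_map (x : H) : E (T x) = T (E x) :=
  congrArg (fun A : H →L[ℂ] H => A x) G.commute.eq

theorem norm_apply_le (x : H) : ‖E x‖ ≤ ‖x‖ :=
  (isEffect_of_projection G.isSelfAdjoint_proj G.proj_mul_self).norm_apply_le x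

theorem isSelfAdjoint_compl : IsSelfAdjoint (1 - E) :=
  (IsSelfAdjoint.one _).sub G.isSelfAdjoint_proj

theorem compl_mul_self : (1 - E) * (1 - E) = 1 - E := by
  rw [mul_sub, mul_one, sub_mul, one_mul, G.proj_mul_self, sub_self, sub_zero]

theorem norm_sub_apply_le (x : H) : ‖x - E x‖ ≤ ‖x‖ :=
  (isEffect_of_projection G.isSelfAdjoint_compl G.compl_mul_self).norm_apply_le x

theorem kappa_pos : 0 < (h₂ ^ 2 - h ^ 2) / (2 * h₂ + 5) := by
  have h1 := G.nonneg
  have h2 := G.lt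
  refine div_pos ?_ (by linarith)
  nlinarith

theorem compl_bound {Q : H →L[ℂ] H} (hQ : IsEffect Q) {ζ : ℂ}
    (hζ : (ζ.re - m) ^ 2 + ζ.im - ζ.im ^ 2 ≤ h ^ 2) (hy : |ζ.im| ≤ 2) (x : H) :
    (h₂ ^ 2 - h ^ 2) / (2 * h₂ + 5) * ‖x - E x‖ ≤
      ‖T (x - E x) + Complex.I • ((1 - E) * Q * (1 - E)) x - ζ • (x - E x)‖ := by
  have key := le_norm_add_effect G.isSelfAdjoint
    (hQ.compress G.isSelfAdjoint_compl G.compl_mul_self) G.nonneg G.lt (G.gap x) hζ hy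
  have : ((1 - E) * Q * (1 - E)) (x - E x) = ((1 - E) * Q * (1 - E)) x := by
    simp [G.apply_apply]
  rwa [this] at key

theorem norm_mul_compl_le {Q : H →L[ℂ] H} (hQ : IsEffect Q) :
    ‖E * (1 - Q)‖ = ‖(1 - Q) * E‖ := by
  rw [← norm_star ((1 - Q) * E), star_mul, star_sub, star_one, G.isSelfAdjoint_proj.star_eq,
    hQ.isSelfAdjoint.star_eq]

/-- Apply `E` to `(T + iQ - ζ) x` and write `EQ = E - E(1 - Q)`: on `ran E` the full shift by `i`
appears, with errors controlled by `1 - Q`. -/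
theorem proj_bound {Q : H →L[ℂ] H} (hQ : IsEffect Q) {ζ : ℂ} {D : ℝ}
    (hD : ∀ x, D * ‖E x‖ ≤ ‖T (E x) - (ζ - Complex.I) • E x‖) (x : H) :
    (D - ‖E * (1 - Q) * E‖) * ‖E x‖ ≤
      ‖T x + Complex.I • Q x - ζ • x‖ + ‖(1 - Q) * E‖ * ‖x - E x‖ := by
  have h1 : T (E x) - (ζ - Complex.I) • E x =
      E (T x + Complex.I • Q x - ζ • x) + Complex.I • (E * (1 - Q) * E) (E x)
        + Complex.I • (E * (1 - Q)) (x - E x) := by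
    simp only [map_add, map_sub, map_smul, mul_apply_eq_comp, sub_apply, one_apply_eq_self,
      G.apply_apply, G.apply_map]
    module
  have h2 := hD x
  rw [h1] at h2
  have h3 := norm_add₃_le (a := E (T x + Complex.I • Q x - ζ • x))
    (b := Complex.I • (E * (1 - Q) * E) (E x)) (c := Complex.I • (E * (1 - Q)) (x - E x))
  have h4 := G.norm_apply_le (T x + Complex.I • Q x - ζ • x)
  have h5 := (E * (1 - Q) * E).le_opNorm (E x)
  have h6 := (E * (1 - Q)).le_opNorm (x - E x)
  rw [G.norm_mul_compl_le hQ] at h6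
  rw [norm_smul, norm_smul, Complex.norm_I, one_mul, one_mul] at h3
  linarith

/-- Apply `1 - E` instead; the coupling `(1 - E) Q E` equals `-(1 - E)(1 - Q) E`, so it is small
too. -/
theorem compl_bound_full {Q : H →L[ℂ] H} (hQ : IsEffect Q) {ζ : ℂ}
    (hζ : (ζ.re - m) ^ 2 + ζ.im - ζ.im ^ 2 ≤ h ^ 2) (hy : |ζ.im| ≤ 2) (x : H) :
    (h₂ ^ 2 - h ^ 2) / (2 * h₂ + 5) * ‖x - E x‖ ≤
      ‖T x + Complex.I • Q x - ζ • x‖ + ‖(1 - Q) * E‖ * ‖E x‖ := by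
  have h1 : T (x - E x) + Complex.I • ((1 - E) * Q * (1 - E)) x - ζ • (x - E x) =
      (1 - E) (T x + Complex.I • Q x - ζ • x) + Complex.I • (1 - E) (((1 - Q) * E) (E x)) := by
    simp only [map_add, map_sub, map_smul, mul_apply_eq_comp, sub_apply, one_apply_eq_self,
      G.apply_apply, G.apply_map]
    module
  have h2 := G.compl_bound hQ hζ hy x
  rw [h1] at h2
  have h3 := norm_add_le ((1 - E) (T x + Complex.I • Q x - ζ • x))
    (Complex.I • (1 - E) (((1 - Q) * E) (E x)))
  have h4 := G.norm_sub_apply_le (T x + Complex.I • Q x - ζ • x)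
  have h5 := G.norm_sub_apply_le (((1 - Q) * E) (E x))
  have h6 := ((1 - Q) * E).le_opNorm (E x)
  rw [norm_smul, Complex.norm_I, one_mul] at h3
  simp only [sub_apply, one_apply_eq_self] at h3 h4 h5 h2
  linarith

/-- A quantitative bound on the inverse of `T + iQ - ζ` for `0 ≤ Q ≤ 1` such that
`‖(1 - Q) E‖` is small. -/
theorem norm_le {Q : H →L[ℂ] H} (hQ : IsEffect Q) {ζ : ℂ}
    (hζ : (ζ.re - m) ^ 2 + ζ.im - ζ.im ^ 2 ≤ h ^ 2) (hy : |ζ.im| ≤ 2) {D : ℝ}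
    (hD : ∀ x, D * ‖E x‖ ≤ ‖T (E x) - (ζ - Complex.I) • E x‖)
    {κ g d : ℝ} (hκ : κ = (h₂ ^ 2 - h ^ 2) / (2 * h₂ + 5)) (hg : ‖(1 - Q) * E‖ ≤ g)
    (hd : 0 < d) (hDd : ‖E * (1 - Q) * E‖ + g ^ 2 / κ + d ≤ D) (x : H) :
    ‖x‖ ≤ ((1 + g / κ) ^ 2 / d + κ⁻¹) * ‖T x + Complex.I • Q x - ζ • x‖ := by
  have hκ0 : 0 < κ := hκ ▸ G.kappa_pos
  have hg0 : 0 ≤ g := (norm_nonneg _).trans hg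
  have h1 := G.proj_bound hQ hD x
  have h2 := G.compl_bound_full hQ hζ hy x
  rw [← hκ] at h2
  set f := ‖T x + Complex.I • Q x - ζ • x‖
  set v := ‖E x‖
  set w := ‖x - E x‖
  have hv : 0 ≤ v := norm_nonneg _
  have hw : 0 ≤ w := norm_nonneg _
  have h3 : w ≤ (f + g * v) / κ := by
    rw [le_div_iff₀ hκ0]
    nlinarith
  -- Elimination of the `ker E` component, as in a Schur complement; it costs the `g² / κ` reserved
  -- in `hDd`.
  have h4 : d * v ≤ (1 + g / κ) * f := by
    have h5 : (g ^ 2 / κ + d) * v ≤ f + g * ((f + g * v) / κ) := by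
      have h6 : (g ^ 2 / κ + d) * v ≤ (D - ‖E * (1 - Q) * E‖) * v := by gcongr; linarith
      have h7 : ‖(1 - Q) * E‖ * w ≤ g * ((f + g * v) / κ) := by gcongr
      linarith
    have h8 : f + g * ((f + g * v) / κ) = (1 + g / κ) * f + g ^ 2 / κ * v := by ring
    linarith
  have h9 : v ≤ (1 + g / κ) * f / d := by rw [le_div_iff₀ hd]; linarith
  have h10 : ‖x‖ ≤ v + w := by
    have := norm_add_le (E x) (x - E x)
    rwa [add_sub_cancel] at this
  calc ‖x‖ ≤ v + (f + g * v) / κ := by linarith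
    _ = (1 + g / κ) * v + κ⁻¹ * f := by ring
    _ ≤ (1 + g / κ) * ((1 + g / κ) * f / d) + κ⁻¹ * f := by gcongr
    _ = _ := by ring

end ReducingGap

/-- A finite rank perturbation of a self-adjoint operator: a non-real `ζ` is in the resolvent set
as soon as it is not an eigenvalue. -/
theorem mem_resolventSet_of_injective {T F : H →L[ℂ] H} (hT : IsSelfAdjoint T)
    [FiniteDimensional ℂ (LinearMap.range (F : H →ₗ[ℂ] H))] {ζ : ℂ} (hζ : ζ.im ≠ 0)
    (hinj : ∀ x, (T + F) x - ζ • x = 0 → x = 0) : ζ ∈ resolventSet ℂ (T + F) := by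
  have h1 : IsUnit (algebraMap ℂ (H →L[ℂ] H) ζ - T) := by
    by_contra hnot
    exact hζ (hT.im_eq_zero_of_mem_spectrum hnot)
  obtain ⟨R, hR⟩ := h1.exists_right_inv
  have hR' : ∀ y, ζ • R y - T (R y) = y := fun y => by
    have := congrArg (fun A : H →L[ℂ] H => A y) hR
    simpa [Algebra.algebraMap_eq_smul_one] using this
  set V := LinearMap.range (F : H →ₗ[ℂ] H)
  have hFV : ∀ x, F x ∈ V := fun x => ⟨x, rfl⟩
  -- With `R = (ζ - T)⁻¹`, the factorisation `ζ - T - F = (1 - F R)(ζ - T)` reduces invertibility to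
  -- that of `1 - F R` on the finite-dimensional range of `F`, where injective means surjective.
  let ψ : V →ₗ[ℂ] V := ((F ∘L R : H →L[ℂ] H) : H →ₗ[ℂ] H).codRestrict V
    (fun x => hFV (R x)) ∘ₗ V.subtype
  have hψ : ∀ v : V, (ψ v : H) = F (R v) := fun v => rfl
  have hψinj : Function.Injective (LinearMap.id (R := ℂ) (M := V) - ψ) := by
    rw [injective_iff_map_eq_zero]
    intro v hv
    have h2 : (v : H) = F (R v) := by
      rw [← hψ, ← sub_eq_zero]
      exact congrArg Subtype.val hv
    have h3 : R (v : H) = 0 := by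
      apply hinj
      have h4 := hR' v
      rw [add_apply, ← h2]
      nth_rewrite 2 [← h4]
      abel
    rw [h3, map_zero] at h2
    exact Subtype.ext h2
  have hψsurj := LinearMap.injective_iff_surjective.1 hψinj
  rw [spectrum.mem_resolventSet_iff, ContinuousLinearMap.isUnit_iff_bijective]
  have happ : ∀ x, (algebraMap ℂ (H →L[ℂ] H) ζ - (T + F)) x = ζ • x - (T x + F x) := fun x => by
    simp [Algebra.algebraMap_eq_smul_one]
  constructor
  · rw [injective_iff_map_eq_zero]
    intro x hx
    apply hinj
    rw [happ] at hx
    rw [add_apply, ← neg_eq_zero, ← hx]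
    abel
  · intro y
    obtain ⟨v, hv⟩ := hψsurj ⟨F (R y), hFV _⟩
    have hv' : (v : H) - F (R v) = F (R y) := congrArg Subtype.val hv
    refine ⟨R (y + v), ?_⟩
    have h2 := hR' (y + v)
    rw [happ, ← sub_sub, h2, map_add, map_add, ← hv']
    abel

omit [CompleteSpace H] in
theorem norm_resolvent_apply_le {A : H →L[ℂ] H} {ζ : ℂ} {C : ℝ} (h : ζ ∈ resolventSet ℂ A)
    (hC : ∀ x, ‖x‖ ≤ C * ‖A x - ζ • x‖) (y : H) : ‖resolvent A ζ y‖ ≤ C * ‖y‖ := by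
  have h1 := congrArg (fun B : H →L[ℂ] H => B y) (Ring.mul_inverse_cancel _ h)
  have h2 : ζ • resolvent A ζ y - A (resolvent A ζ y) = y := by
    simpa [Algebra.algebraMap_eq_smul_one, resolvent] using h1
  have h3 := hC (resolvent A ζ y)
  rwa [norm_sub_rev, h2] at h3

end GapEstimates

/-! ### Riesz projections: idempotence, rank and perturbation -/

section Riesz

theorem circleIntegral_clm_apply {E F : Type*} [NormedAddCommGroup E] [NormedSpace ℂ E]
    [CompleteSpace E] [NormedAddCommGroup F] [NormedSpace ℂ F] [CompleteSpace F] (L : E →L[ℂ] F)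
    {f : ℂ → E} {c : ℂ} {R : ℝ} (hf : CircleIntegrable f c R) :
    L (∮ z in C(c, R), f z) = ∮ z in C(c, R), L (f z) := by
  unfold circleIntegral
  rw [← ContinuousLinearMap.intervalIntegral_comp_comm L hf.out]
  simp only [map_smul]

variable {H : Type*} [NormedAddCommGroup H] [InnerProductSpace ℂ H] [CompleteSpace H]

theorem differentiableAt_resolvent {A : H →L[ℂ] H} {z : ℂ} (hz : z ∈ resolventSet ℂ A) :
    DifferentiableAt ℂ (resolvent A) z :=
  (spectrum.hasDerivAt_resolvent_const_left hz).differentiableAt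

theorem continuousOn_resolvent (A : H →L[ℂ] H) :
    ContinuousOn (resolvent A) (resolventSet ℂ A) :=
  fun _ hz => (differentiableAt_resolvent hz).continuousAt.continuousWithinAt

theorem circleIntegrable_resolvent {A : H →L[ℂ] H} {c : ℂ} {R : ℝ} (hR : 0 ≤ R)
    (h : Metric.sphere c R ⊆ resolventSet ℂ A) : CircleIntegrable (resolvent A) c R :=
  ((continuousOn_resolvent A).mono h).circleIntegrable hR

theorem rieszProjection_eq_of_annulus {A : H →L[ℂ] H} {c : ℂ} {r R : ℝ} (hr : 0 < r)
    (hrR : r ≤ R) (h : Metric.closedBall c R \ Metric.ball c r ⊆ resolventSet ℂ A) :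
    rieszProjection A c R = rieszProjection A c r := by
  unfold rieszProjection
  rw [Complex.circleIntegral_eq_of_differentiable_on_annulus_off_countable hr hrR
    Set.countable_empty ((continuousOn_resolvent A).mono h)]
  rintro z ⟨⟨hz1, hz2⟩, -⟩
  exact differentiableAt_resolvent (h ⟨Metric.ball_subset_closedBall hz1,
    fun hz => hz2 (Metric.ball_subset_closedBall hz)⟩)

omit [CompleteSpace H] in
theorem resolvent_mul_resolvent {A : H →L[ℂ] H} {z w : ℂ} (hz : z ∈ resolventSet ℂ A)
    (hw : w ∈ resolventSet ℂ A) (hzw : z ≠ w) :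
    resolvent A z * resolvent A w = (z - w)⁻¹ • (resolvent A w - resolvent A z) := by
  have h1 : resolvent A z * (algebraMap ℂ (H →L[ℂ] H) z - A) = 1 :=
    Ring.inverse_mul_cancel _ hz
  have h2 : (algebraMap ℂ (H →L[ℂ] H) w - A) * resolvent A w = 1 :=
    Ring.mul_inverse_cancel _ hw
  have h3 : resolvent A w - resolvent A z =
      (z - w) • (resolvent A z * resolvent A w) := by
    calc resolvent A w - resolvent A z
        = (resolvent A z * (algebraMap ℂ (H →L[ℂ] H) z - A)) * resolvent A w -
          resolvent A z * ((algebraMap ℂ (H →L[ℂ] H) w - A) * resolvent A w) := by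
            rw [h1, h2, one_mul, mul_one]
      _ = resolvent A z * (algebraMap ℂ (H →L[ℂ] H) z - algebraMap ℂ (H →L[ℂ] H) w) *
            resolvent A w := by noncomm_ring
      _ = _ := by
        rw [← map_sub, Algebra.algebraMap_eq_smul_one, mul_smul_comm, mul_one, smul_mul_assoc]
  rw [h3, smul_smul, inv_mul_cancel₀ (sub_ne_zero.2 hzw), one_smul]

theorem rieszProjection_mul_resolvent {A : H →L[ℂ] H} {c w : ℂ} {R : ℝ} (hR : 0 < R)
    (h : Metric.sphere c R ⊆ resolventSet ℂ A) (hw : w ∈ Metric.ball c R)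
    (hwA : w ∈ resolventSet ℂ A) :
    rieszProjection A c R * resolvent A w = resolvent A w -
      (2 * (Real.pi : ℂ) * Complex.I)⁻¹ • ∮ z in C(c, R), (z - w)⁻¹ • resolvent A z := by
  have hne : ∀ z ∈ Metric.sphere c R, z ≠ w := by
    rintro z hz rfl
    rw [Metric.mem_ball] at hw
    exact hw.ne hz
  have hcont : ContinuousOn (fun z => (z - w)⁻¹) (Metric.sphere c R) :=
    (continuousOn_id.sub continuousOn_const).inv₀ fun z hz => sub_ne_zero.2 (hne z hz)
  have h1 := circleIntegral_clm_apply ((ContinuousLinearMap.mul ℂ (H →L[ℂ] H)).flip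
    (resolvent A w)) (circleIntegrable_resolvent hR.le h)
  simp only [ContinuousLinearMap.flip_apply, ContinuousLinearMap.mul_apply'] at h1
  unfold rieszProjection
  rw [smul_mul_assoc, h1, circleIntegral.integral_congr hR.le
    (g := fun z => (z - w)⁻¹ • resolvent A w - (z - w)⁻¹ • resolvent A z)
    (fun z hz => by rw [resolvent_mul_resolvent (h hz) hwA (hne z hz), smul_sub]),
    circleIntegral.integral_sub, smul_sub, circleIntegral.integral_smul_const,
    circleIntegral.integral_sub_inv_of_mem_ball hw, smul_smul, inv_mul_cancel₀, one_smul]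
  · exact Complex.two_pi_I_ne_zero
  · exact (hcont.smul continuousOn_const).circleIntegrable hR.le
  · exact (hcont.smul ((continuousOn_resolvent A).mono h)).circleIntegrable hR.le

/-- Multiply the projections for two concentric circles. By the resolvent identity the outer one
reproduces the resolvent on the inner circle up to the Cauchy integral `K`, which is holomorphic
inside the outer circle and so integrates to zero over the inner one. -/
theorem rieszProjection_mul_self {A : H →L[ℂ] H} {c : ℂ} {r R : ℝ} (hr : 0 < r)
    (hrR : r < R) (h : Metric.closedBall c R \ Metric.ball c r ⊆ resolventSet ℂ A) :
    rieszProjection A c R * rieszProjection A c R = rieszProjection A c R := by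
  have hR := hr.trans hrR
  lift R to NNReal using hR.le
  have hsR : Metric.sphere c R ⊆ resolventSet ℂ A := fun z hz => h
    ⟨Metric.sphere_subset_closedBall hz, by
      rw [Metric.mem_ball, Metric.mem_sphere.1 hz]; exact hrR.not_gt⟩
  have hsr : Metric.sphere c r ⊆ resolventSet ℂ A := fun z hz => h
    ⟨by rw [Metric.mem_closedBall, Metric.mem_sphere.1 hz]; exact hrR.le, by
      rw [Metric.mem_ball, Metric.mem_sphere.1 hz]; exact lt_irrefl _⟩
  suffices hs : rieszProjection A c R * rieszProjection A c r = rieszProjection A c r by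
    rwa [← rieszProjection_eq_of_annulus hr hrR.le h] at hs
  set P := rieszProjection A c R with hP
  set K : ℂ → (H →L[ℂ] H) := fun w =>
    (2 * (Real.pi : ℂ) * Complex.I)⁻¹ • ∮ z in C(c, R), (z - w)⁻¹ • resolvent A z with hK
  have hKdiff : DifferentiableOn ℂ K (Metric.ball c R) := by
    have hps := hasFPowerSeriesOn_cauchy_integral (circleIntegrable_resolvent hR.le hsR)
      (NNReal.coe_pos.1 hR)
    rw [← Metric.eball_coe]
    exact hps.differentiableOn
  have hsub : Metric.closedBall c r ⊆ Metric.ball c R := Metric.closedBall_subset_ball hrR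
  have hK0 : ∮ w in C(c, r), K w = 0 :=
    Complex.circleIntegral_eq_zero_of_differentiable_on_off_countable hr.le Set.countable_empty
      (hKdiff.continuousOn.mono hsub) fun z hz =>
        hKdiff.differentiableAt (Metric.isOpen_ball.mem_nhds
          (hsub (Metric.ball_subset_closedBall hz.1)))
  have h1 := circleIntegral_clm_apply (ContinuousLinearMap.mul ℂ (H →L[ℂ] H) P)
    (circleIntegrable_resolvent hr.le hsr)
  simp only [ContinuousLinearMap.mul_apply'] at h1
  conv_lhs => rw [rieszProjection]
  rw [mul_smul_comm, h1, circleIntegral.integral_congr hr.le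
    (g := fun w => resolvent A w - K w) (fun w hw => rieszProjection_mul_resolvent hR hsR
      (hsub (Metric.sphere_subset_closedBall hw)) (hsr hw)),
    circleIntegral.integral_sub (circleIntegrable_resolvent hr.le hsr)
      ((hKdiff.continuousOn.mono (Metric.sphere_subset_closedBall.trans hsub)).circleIntegrable
        hr.le), hK0, sub_zero]
  rfl

omit [CompleteSpace H] in
-- A vector of `ran P` killed by `E` is fixed by `P - E`, hence zero; so `E` embeds `ran P` in `ran
-- E`, and symmetrically.
theorem finrank_range_eq_of_norm_sub_lt_one {P E : H →L[ℂ] H} (hP : P * P = P) (hE : E * E = E)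
    (h : ‖P - E‖ < 1) [FiniteDimensional ℂ (LinearMap.range (E : H →ₗ[ℂ] H))] :
    Module.finrank ℂ (LinearMap.range (P : H →ₗ[ℂ] H)) =
      Module.finrank ℂ (LinearMap.range (E : H →ₗ[ℂ] H)) := by
  have aux : ∀ {P E : H →L[ℂ] H}, P * P = P → ‖P - E‖ < 1 → Function.Injective
      ((E : H →ₗ[ℂ] H).rangeRestrict ∘ₗ (LinearMap.range (P : H →ₗ[ℂ] H)).subtype) := by
    intro P E hP h
    rw [injective_iff_map_eq_zero]
    rintro ⟨_, y, rfl⟩ hx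
    have h1 : E (P y) = 0 := congrArg Subtype.val hx
    have h2 : P (P y) = P y := congrArg (fun A : H →L[ℂ] H => A y) hP
    have h3 := (P - E).le_opNorm (P y)
    rw [sub_apply, h1, h2, sub_zero] at h3
    have h4 : P y = 0 := by
      rw [← norm_le_zero_iff]
      by_contra hlt
      nlinarith
    exact Subtype.ext h4
  have h1 := aux hP h
  have h2 := aux hE (by rwa [norm_sub_rev])
  have : FiniteDimensional ℂ (LinearMap.range (P : H →ₗ[ℂ] H)) := Module.Finite.of_injective _ h1
  exact le_antisymm (LinearMap.finrank_le_finrank_of_injective h1)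
    (LinearMap.finrank_le_finrank_of_injective h2)

/-- Comparison of the Riesz projection of `A` with a projection `P` reducing an operator `B` that
has no spectrum in the disc, when `A` is close to `B + iP`. -/
theorem norm_rieszProjection_sub_le {A B P : H →L[ℂ] H} {c : ℂ} {R C₁ C₂ η : ℝ} (hR : 0 < R)
    (hA : Metric.sphere c R ⊆ resolventSet ℂ A) (hB : Metric.closedBall c R ⊆ resolventSet ℂ B)
    (hC₁ : ∀ z ∈ Metric.sphere c R, ‖resolvent A z‖ ≤ C₁)
    (hC₂ : ∀ z ∈ Metric.sphere c R, ‖resolvent B z‖ ≤ C₂)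
    (hP : P * P = P) (hP1 : ‖P‖ ≤ 1) (hPB : Commute P B) (hBP : B * P = (c - Complex.I) • P)
    (hη : ‖A - (B + Complex.I • P)‖ ≤ η) :
    ‖rieszProjection A c R - P‖ ≤ R * (C₁ * η * (R⁻¹ + C₂ * 2)) := by
  -- `S z` is the resolvent of `B + iP`, which acts as the scalar `c` on `ran P` and as `B` on `ker
  -- P`. Its second term is holomorphic on the disc, so the integral only sees the pole at `c`.
  set S : ℂ → (H →L[ℂ] H) := fun z => (z - c)⁻¹ • P + resolvent B z * (1 - P) with hS
  have hsB : Metric.sphere c R ⊆ resolventSet ℂ B := Metric.sphere_subset_closedBall.trans hB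
  have hne : ∀ z ∈ Metric.sphere c R, z - c ≠ 0 := by
    intro z hz h0
    rw [Metric.mem_sphere, dist_eq_norm, h0, norm_zero] at hz
    exact hR.ne hz
  have hcont : ContinuousOn (fun z => (z - c)⁻¹) (Metric.sphere c R) :=
    (continuousOn_id.sub continuousOn_const).inv₀ hne
  have hi1 : CircleIntegrable (fun z => (z - c)⁻¹ • P) c R :=
    (hcont.smul continuousOn_const).circleIntegrable hR.le
  have hi2 : CircleIntegrable (fun z => resolvent B z * (1 - P)) c R :=
    (((continuousOn_resolvent B).mono hsB).mul continuousOn_const).circleIntegrable hR.le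
  have hi3 : CircleIntegrable S c R :=
    ((hcont.smul continuousOn_const).add
      (((continuousOn_resolvent B).mono hsB).mul continuousOn_const)).circleIntegrable hR.le
  have hpi : (2 * (Real.pi : ℂ) * Complex.I) ≠ 0 := Complex.two_pi_I_ne_zero
  have hint : ∮ z in C(c, R), S z = (2 * (Real.pi : ℂ) * Complex.I) • P := by
    have h0 : ∮ z in C(c, R), resolvent B z * (1 - P) = 0 :=
      Complex.circleIntegral_eq_zero_of_differentiable_on_off_countable hR.le Set.countable_empty
        (((continuousOn_resolvent B).mono hB).mul continuousOn_const) fun z hz =>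
          (differentiableAt_resolvent (hB (Metric.ball_subset_closedBall hz.1))).mul_const _
    rw [hS, circleIntegral.integral_add hi1 hi2, h0, add_zero, circleIntegral.integral_smul_const,
      circleIntegral.integral_sub_inv_of_mem_ball (Metric.mem_ball_self hR)]
  have hright : ∀ z ∈ Metric.sphere c R,
      (algebraMap ℂ (H →L[ℂ] H) z - (B + Complex.I • P)) * S z = 1 := by
    intro z hz
    have h2 : (algebraMap ℂ (H →L[ℂ] H) z - B) * resolvent B z = 1 :=
      Ring.mul_inverse_cancel _ (hsB hz)
    have h3 : P * resolvent B z = resolvent B z * P := by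
      have h2' : resolvent B z * (algebraMap ℂ (H →L[ℂ] H) z - B) = 1 :=
        Ring.inverse_mul_cancel _ (hsB hz)
      have hc : (algebraMap ℂ (H →L[ℂ] H) z - B) * P = P * (algebraMap ℂ (H →L[ℂ] H) z - B) := by
        rw [sub_mul, mul_sub, hPB.eq, Algebra.commutes]
      calc P * resolvent B z
          = (resolvent B z * (algebraMap ℂ (H →L[ℂ] H) z - B)) * P * resolvent B z := by
            rw [h2', one_mul]
        _ = resolvent B z * ((algebraMap ℂ (H →L[ℂ] H) z - B) * P) * resolvent B z := by
            simp only [mul_assoc]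
        _ = resolvent B z * P * ((algebraMap ℂ (H →L[ℂ] H) z - B) * resolvent B z) := by
            rw [hc]; simp only [mul_assoc]
        _ = _ := by rw [h2, mul_one]
    have h4 : P * (resolvent B z * (1 - P)) = 0 := by
      rw [← mul_assoc, h3, mul_assoc, mul_sub, mul_one, hP, sub_self, mul_zero]
    have h5 : (algebraMap ℂ (H →L[ℂ] H) z - (B + Complex.I • P)) * P = (z - c) • P := by
      rw [sub_mul, add_mul, hBP, smul_mul_assoc, hP, Algebra.algebraMap_eq_smul_one,
        smul_mul_assoc, one_mul]
      module
    rw [hS, mul_add, mul_smul_comm, h5, smul_smul, inv_mul_cancel₀ (hne z hz), one_smul,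
      ← sub_sub, sub_mul, ← mul_assoc, h2, one_mul, smul_mul_assoc, h4, smul_zero, sub_zero]
    abel
  have hdiff : ∀ z ∈ Metric.sphere c R,
      resolvent A z - S z = resolvent A z * (A - (B + Complex.I • P)) * S z := by
    intro z hz
    have h1 : resolvent A z * (algebraMap ℂ (H →L[ℂ] H) z - A) = 1 :=
      Ring.inverse_mul_cancel _ (hA hz)
    calc resolvent A z - S z
        = resolvent A z * ((algebraMap ℂ (H →L[ℂ] H) z - (B + Complex.I • P)) * S z)
          - (resolvent A z * (algebraMap ℂ (H →L[ℂ] H) z - A)) * S z := by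
            rw [hright z hz, h1, mul_one, one_mul]
      _ = _ := by noncomm_ring
  have hnorm : ∀ z ∈ Metric.sphere c R, ‖resolvent A z - S z‖ ≤ C₁ * η * (R⁻¹ + C₂ * 2) := by
    intro z hz
    have hC₁0 := (norm_nonneg _).trans (hC₁ z hz)
    have hC₂0 := (norm_nonneg _).trans (hC₂ z hz)
    have hη0 := (norm_nonneg _).trans hη
    have h1 : ‖(1 : H →L[ℂ] H) - P‖ ≤ 2 := by
      refine (norm_sub_le _ _).trans ?_
      have : ‖(1 : H →L[ℂ] H)‖ ≤ 1 := ContinuousLinearMap.norm_id_le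
      linarith
    have h2 : ‖S z‖ ≤ R⁻¹ + C₂ * 2 := by
      refine (norm_add_le _ _).trans (add_le_add ?_ ?_)
      · rw [norm_smul, norm_inv, ← dist_eq_norm, Metric.mem_sphere.1 hz]
        exact mul_le_of_le_one_right (by positivity) hP1
      · exact (norm_mul_le _ _).trans (mul_le_mul (hC₂ z hz) h1 (norm_nonneg _) hC₂0)
    rw [hdiff z hz]
    refine (norm_mul_le _ _).trans (mul_le_mul ((norm_mul_le _ _).trans
      (mul_le_mul (hC₁ z hz) hη (norm_nonneg _) hC₁0)) h2 (norm_nonneg _) (by positivity))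
  have hfin : rieszProjection A c R - P =
      (2 * (Real.pi : ℂ) * Complex.I)⁻¹ • ∮ z in C(c, R), (resolvent A z - S z) := by
    rw [circleIntegral.integral_sub (circleIntegrable_resolvent hR.le hA) hi3, hint, smul_sub,
      smul_smul, inv_mul_cancel₀ hpi, one_smul]
    rfl
  rw [hfin]
  exact circleIntegral.norm_two_pi_i_inv_smul_integral_le_of_norm_le_const hR.le hnorm

end Riesz

/-! ### Galerkin subspaces and the size of `(1 - Q) E` -/

section Galerkin

variable {H : Type*} [NormedAddCommGroup H] [InnerProductSpace ℂ H]

theorem norm_sub_starProjection_le_gap {M L : Submodule ℂ H} [FiniteDimensional ℂ L] {x : H}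
    (hx : x ∈ M) : ‖x - L.starProjection x‖ ≤ subspaceGap M L * ‖x‖ := by
  rcases eq_or_ne x 0 with rfl | hx0
  · simp
  have hn : ‖x‖ ≠ 0 := norm_ne_zero_iff.2 hx0
  set u : H := ((‖x‖⁻¹ : ℝ) : ℂ) • x with hu
  have hun : ‖u‖ = 1 := by
    rw [hu, norm_smul, Complex.norm_real, norm_inv, norm_norm, inv_mul_cancel₀ hn]
  have hbdd : BddAbove ((fun x : H => Metric.infDist x (L : Set H)) ''
      {x : H | x ∈ M ∧ ‖x‖ = 1}) := by
    refine ⟨1, ?_⟩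
    rintro _ ⟨y, hy, rfl⟩
    have := Metric.infDist_le_dist_of_mem (x := y) (SetLike.mem_coe.2 L.zero_mem)
    rwa [dist_zero_right, hy.2] at this
  have h1 : Metric.infDist u (L : Set H) ≤ subspaceGap M L :=
    le_csSup hbdd ⟨u, ⟨M.smul_mem _ hx, hun⟩, rfl⟩
  have h2 : ‖u - L.starProjection u‖ ≤ Metric.infDist u (L : Set H) := by
    rw [Metric.le_infDist ⟨0, L.zero_mem⟩]
    intro y hy
    rw [Submodule.starProjection_minimal, dist_eq_norm]
    exact ciInf_le ⟨0, by rintro _ ⟨z, rfl⟩; exact norm_nonneg _⟩ (⟨y, hy⟩ : L)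
  have h3 : x - L.starProjection x = (‖x‖ : ℂ) • (u - L.starProjection u) := by
    rw [hu, map_smul, smul_sub, smul_smul, smul_smul, ← Complex.ofReal_mul, mul_inv_cancel₀ hn]
    simp
  rw [h3, norm_smul, Complex.norm_real, norm_norm, mul_comm]
  exact mul_le_mul_of_nonneg_right (h2.trans h1) (norm_nonneg _)

theorem subspaceGap_nonneg (M L : Submodule ℂ H) : 0 ≤ subspaceGap M L := by
  apply Real.sSup_nonneg
  rintro _ ⟨x, -, rfl⟩
  exact Metric.infDist_nonneg

/-- Strong approximation becomes uniform on the unit sphere of a finite-dimensional `M`: approximate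
an orthonormal basis and add the errors. -/
theorem tendsto_subspaceGap {M : Submodule ℂ H} [FiniteDimensional ℂ M] {L : ℕ → Submodule ℂ H}
    (hL : ∀ φ : H, ∃ u : ℕ → H, (∀ n, u n ∈ L n) ∧ Tendsto u atTop (𝓝 φ)) :
    Tendsto (fun n => subspaceGap M (L n)) atTop (𝓝 0) := by
  let e := stdOrthonormalBasis ℂ M
  choose u hu hlim using fun i => hL (e i : H)
  have hsum : Tendsto (fun n => ∑ i, ‖(e i : H) - u i n‖) atTop (𝓝 0) := by
    have : Tendsto (fun n => ∑ i, ‖(e i : H) - u i n‖) atTop (𝓝 (∑ i, ‖(e i : H) - e i‖)) :=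
      tendsto_finsetSum _ fun i _ => (tendsto_const_nhds.sub (hlim i)).norm
    simpa using this
  refine squeeze_zero (fun n => subspaceGap_nonneg _ _) (fun n => ?_) hsum
  apply Real.sSup_le _ (Finset.sum_nonneg fun i _ => norm_nonneg _)
  rintro _ ⟨x, ⟨hxM, hx1⟩, rfl⟩
  set c := fun i => e.repr ⟨x, hxM⟩ i
  have hx : x = ∑ i, c i • (e i : H) := by
    have := congrArg Subtype.val (e.sum_repr ⟨x, hxM⟩)
    simpa [c] using this.symm
  have hc : ∀ i, ‖c i‖ ≤ 1 := by
    intro i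
    have h1 : c i = inner ℂ (e i) ⟨x, hxM⟩ := e.repr_apply_apply _ _
    rw [h1]
    refine (norm_inner_le_norm _ _).trans ?_
    rw [e.norm_eq_one, one_mul]
    exact hx1.le
  have hmem : ∑ i, c i • u i n ∈ L n := Submodule.sum_mem _ fun i _ => (L n).smul_mem _ (hu i n)
  refine (Metric.infDist_le_dist_of_mem (SetLike.mem_coe.2 hmem)).trans ?_
  rw [dist_eq_norm, hx, ← Finset.sum_sub_distrib]
  refine (norm_sum_le _ _).trans (Finset.sum_le_sum fun i _ => ?_)
  rw [← smul_sub, norm_smul]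
  exact mul_le_of_le_one_left (norm_nonneg _) (hc i)

variable [CompleteSpace H] {T : H →L[ℂ] H}

theorem isSelfAdjoint_galerkinCompression (hT : IsSelfAdjoint T) (L : Submodule ℂ H)
    [FiniteDimensional ℂ L] : IsSelfAdjoint (galerkinCompression T L) := by
  rw [ContinuousLinearMap.isSelfAdjoint_iff_isSymmetric]
  intro x y
  have h1 : inner ℂ (T x) (y : H) = inner ℂ (x : H) (T y) := hT.isSymmetric x y
  simp only [galerkinCompression, ContinuousLinearMap.coe_coe, ContinuousLinearMap.comp_apply,
    Submodule.subtypeL_apply]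
  rw [Submodule.inner_orthogonalProjectionOnto_eq_of_mem_right,
    Submodule.inner_orthogonalProjectionOnto_eq_of_mem_left, h1]

theorem isSelfAdjoint_galerkinProjection (T : H →L[ℂ] H) (L : Submodule ℂ H)
    [FiniteDimensional ℂ L] (J : Set ℝ) : IsSelfAdjoint (galerkinProjection T L J) := by
  have h1 := isSelfAdjoint_starProjection (eigenspaceSpan (galerkinCompression T L) J)
  rw [IsSelfAdjoint, ContinuousLinearMap.star_eq_adjoint, galerkinProjection,
    ContinuousLinearMap.adjoint_comp, ContinuousLinearMap.adjoint_comp, Submodule.adjoint_subtypeL,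
    Submodule.adjoint_orthogonalProjectionOnto, ← ContinuousLinearMap.star_eq_adjoint, h1.star_eq,
    ContinuousLinearMap.comp_assoc]

omit [CompleteSpace H] in
theorem galerkinProjection_mul_self (T : H →L[ℂ] H) (L : Submodule ℂ H)
    [FiniteDimensional ℂ L] (J : Set ℝ) :
    galerkinProjection T L J * galerkinProjection T L J = galerkinProjection T L J := by
  ext x
  have h1 : ∀ y, (eigenspaceSpan (galerkinCompression T L) J).starProjection
      ((eigenspaceSpan (galerkinCompression T L) J).starProjection y) =
      (eigenspaceSpan (galerkinCompression T L) J).starProjection y := fun y =>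
    congrArg (fun A : L →L[ℂ] L => A y)
      (eigenspaceSpan (galerkinCompression T L) J).isIdempotentElem_starProjection.eq
  simp only [galerkinProjection, mul_apply_eq_comp, ContinuousLinearMap.comp_apply,
    Submodule.subtypeL_apply, Submodule.orthogonalProjectionOnto_mem_subspace_eq_self, h1]

instance finiteDimensional_range_galerkinProjection (T : H →L[ℂ] H) (L : Submodule ℂ H)
    [FiniteDimensional ℂ L] (J : Set ℝ) :
    FiniteDimensional ℂ (LinearMap.range (galerkinProjection T L J : H →ₗ[ℂ] H)) := by
  refine Submodule.finiteDimensional_of_le (S₂ := L) ?_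
  rintro _ ⟨x, rfl⟩
  exact Subtype.property _

theorem starProjection_eigenspaceSpan_galerkinCompression (hT : IsSelfAdjoint T)
    (L : Submodule ℂ H) [FiniteDimensional ℂ L] (J : Set ℝ) :
    (eigenspaceSpan (galerkinCompression T L) J).starProjection =
      specProj (galerkinCompression T L) J := by
  refine starProjection_eq_of_range (isSelfAdjoint_specProj _ _)
    (specProj_mul_self (specClopen_of_finiteDimensional _ _)) ?_
  exact range_specProj (isSelfAdjoint_galerkinCompression hT L)
    ((finite_spectrum_of_finiteDimensional _).inter_of_left _)
    fun x _ => specClopen_of_finiteDimensional _ _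

/-- Besides the part of `ran E` outside `L`, one has to bound `X = F p E`, where `F` is the spectral
projection of the compression `S` off `J`. It nearly intertwines `S` with `T`, while `|S - m| ≥ h`
on `ran F` and `|T - m| ≤ h' < h` on `ran E`; so `X` is at most the defect divided by `h - h'`. -/
theorem norm_one_sub_galerkinProjection_mul_le {E : H →L[ℂ] H} (hT : IsSelfAdjoint T)
    (hE : IsEffect E) (hEE : E * E = E) (hET : Commute E T) (L : Submodule ℂ H)
    [FiniteDimensional ℂ L] {J : Set ℝ} {m h h' δ : ℝ} (hh' : 0 ≤ h') (hh : h' < h)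
    (hJ : ∀ t ∉ J, h ≤ |t - m|)
    (hEm : ∀ x, ‖T (E x) - (m : ℂ) • E x‖ ≤ h' * ‖E x‖) (hδ : 0 ≤ δ)
    (hEL : ∀ x, ‖E x - L.starProjection (E x)‖ ≤ δ * ‖E x‖) :
    ‖(1 - galerkinProjection T L J) * E‖ ≤ (1 + ‖T‖ / (h - h')) * δ := by
  set S := galerkinCompression T L with hS
  have hSa : IsSelfAdjoint S := isSelfAdjoint_galerkinCompression hT L
  have hJc : SpecClopen S Jᶜ := specClopen_of_finiteDimensional _ _
  set p := L.orthogonalProjectionOnto with hp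
  set F := specProj S Jᶜ with hF
  have hFeff : IsEffect F := isEffect_of_projection (isSelfAdjoint_specProj _ _)
    (specProj_mul_self hJc)
  set X : H →L[ℂ] L := F ∘L p ∘L E with hX
  have hpy : ∀ y, ‖p y‖ ≤ ‖y‖ := fun y => Submodule.norm_orthogonalProjectionOnto_apply_le _ _
  have hEEx : ∀ x, E (E x) = E x := fun x => congrArg (fun A : H →L[ℂ] H => A x) hEE
  have hETx : ∀ x, E (T x) = T (E x) := fun x => congrArg (fun A : H →L[ℂ] H => A x) hET.eq
  have hFS : ∀ y, S (F y) = F (S y) := fun y =>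
    (congrArg (fun A : L →L[ℂ] L => A y) (specProj_commute hSa Jᶜ).eq).symm
  have hh0 : 0 < h := hh'.trans_lt hh
  have hXb : h * ‖X‖ ≤ h' * ‖X‖ + ‖T‖ * δ := by
    rw [← le_div_iff₀' hh0]
    refine X.opNorm_le_bound (by positivity) fun x => ?_
    have h1 : h * ‖X x‖ ≤ ‖S (X x) - (m : ℂ) • X x‖ :=
      le_norm_sub_smul_specProj hSa hJc hh0.le (fun t _ ht => by
        rw [← Complex.ofReal_sub, Complex.norm_real]
        exact hJ t ht) (p (E x))
    -- `S p = p T P` with `P` the projection onto `L`; replacing `P` by the identity leaves the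
    -- defect, of size `‖T‖ δ`.
    have h2 : S (X x) - (m : ℂ) • X x =
        X (T (E x) - (m : ℂ) • E x) - F (p (T (E x - L.starProjection (E x)))) := by
      have h3 : S (p (E x)) = p (T (L.starProjection (E x))) := rfl
      simp only [hX, ContinuousLinearMap.comp_apply, hFS, h3, map_sub, map_smul, hETx, hEEx]
      abel
    have h4 : ‖X (T (E x) - (m : ℂ) • E x)‖ ≤ ‖X‖ * (h' * ‖E x‖) :=
      (X.le_opNorm _).trans (mul_le_mul_of_nonneg_left (hEm x) (norm_nonneg _))
    have h5 : ‖F (p (T (E x - L.starProjection (E x))))‖ ≤ ‖T‖ * (δ * ‖E x‖) :=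
      (hFeff.norm_apply_le _).trans ((hpy _).trans ((T.le_opNorm _).trans
        (mul_le_mul_of_nonneg_left (hEL x) (norm_nonneg _))))
    have h6 := norm_sub_le (X (T (E x) - (m : ℂ) • E x))
      (F (p (T (E x - L.starProjection (E x)))))
    have h7 : (h' * ‖X‖ + ‖T‖ * δ) * ‖E x‖ ≤ (h' * ‖X‖ + ‖T‖ * δ) * ‖x‖ :=
      mul_le_mul_of_nonneg_left (hE.norm_apply_le x) (by positivity)
    rw [h2] at h1
    rw [div_mul_eq_mul_div, le_div_iff₀ hh0]
    linarith
  have hXb' : ‖X‖ ≤ ‖T‖ / (h - h') * δ := by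
    rw [div_mul_eq_mul_div, le_div_iff₀ (sub_pos.2 hh)]
    linarith
  have hrhs : (1 + ‖T‖ / (h - h')) * δ = δ + ‖T‖ / (h - h') * δ := by ring
  have hd0 : 0 ≤ ‖T‖ / (h - h') * δ := (norm_nonneg X).trans hXb'
  rw [hrhs]
  refine ContinuousLinearMap.opNorm_le_bound _ (by positivity) fun x => ?_
  have h1 : ((1 - galerkinProjection T L J) * E) x =
      (E x - L.starProjection (E x)) + (X x : H) := by
    have h2 : (X x : H) = L.starProjection (E x) - galerkinProjection T L J (E x) := by
      have h3 : X x = p (E x) - (eigenspaceSpan S J).starProjection (p (E x)) := by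
        rw [starProjection_eigenspaceSpan_galerkinCompression hT L J, hX, hF,
          specProj_compl hSa (specClopen_of_finiteDimensional _ _)]
        rfl
      rw [h3]
      rfl
    rw [h2, mul_apply_eq_comp, sub_apply, one_apply_eq_self]
    abel
  rw [h1, add_mul]
  refine (norm_add_le _ _).trans (add_le_add ?_ ?_)
  · exact (hEL x).trans (mul_le_mul_of_nonneg_left (hE.norm_apply_le x) hδ)
  · exact (X.le_opNorm x).trans (mul_le_mul_of_nonneg_right hXb' (norm_nonneg _))

end Galerkin

/-! ### Plane geometry of the region and of small discs about `x + i` -/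

section Regions

/-- Multiplying the two disc conditions gives `1 - y² ≤ (x - a)(b - x)` for `z = x + iy`. As `(x -
m)² = h² - (x - a)(b - x)`, the left side is at most `h² - 1 + y ≤ h²`. -/
theorem re_im_bound_of_region {a b : ℝ} {z : ℂ} (ha : a ≤ z.re) (hb : z.re ≤ b) (h0 : 0 ≤ z.im)
    (h1 : z.im ≤ 1) (hza : 1 ≤ ‖z - (a : ℂ)‖) (hzb : 1 ≤ ‖z - (b : ℂ)‖) :
    (z.re - (a + b) / 2) ^ 2 + z.im - z.im ^ 2 ≤ ((b - a) / 2) ^ 2 := by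
  have hsq : ∀ c : ℝ, 1 ≤ ‖z - (c : ℂ)‖ → 1 - z.im ^ 2 ≤ (z.re - c) ^ 2 := by
    intro c hc
    have := pow_le_pow_left₀ zero_le_one hc 2
    rw [← Complex.normSq_eq_norm_sq, Complex.normSq_apply] at this
    simp at this
    linarith
  have h2 := hsq a hza
  have h3 := hsq b hzb
  have h4 : 0 ≤ 1 - z.im ^ 2 := by nlinarith
  have h5 : 0 ≤ (z.re - a) * (b - z.re) := mul_nonneg (by linarith) (by linarith)
  have h6 : (1 - z.im ^ 2) ^ 2 ≤ ((z.re - a) * (b - z.re)) ^ 2 := by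
    calc (1 - z.im ^ 2) ^ 2 = (1 - z.im ^ 2) * (1 - z.im ^ 2) := sq _
      _ ≤ (z.re - a) ^ 2 * (z.re - b) ^ 2 := mul_le_mul h2 h3 h4 (sq_nonneg _)
      _ = _ := by ring
  have h7 := le_of_sq_le_sq h6 h5
  nlinarith

theorem exists_radius {x m h D : ℝ} (hx : |x - m| < h) (hD : 0 < D) :
    ∃ ε > 0, ∀ ζ ∈ Metric.closedBall ((x : ℂ) + Complex.I) ε,
      1 / 2 ≤ ζ.im ∧ |ζ.im| ≤ 2 ∧ (ζ.re - m) ^ 2 + ζ.im - ζ.im ^ 2 ≤ h ^ 2 ∧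
      ∀ t : ℝ, D ≤ |t - x| → ε ≤ ‖(t : ℂ) - (ζ - Complex.I)‖ := by
  set q := |x - m|
  have hq : 0 ≤ q := abs_nonneg _
  have hpos : 0 < (h ^ 2 - q ^ 2) / (2 * q + 2) := div_pos (by nlinarith) (by linarith)
  -- At `x + i` the quadratic expression is `q² < h²`; within `ε ≤ 1` it grows by at most `ε (2q +
  -- 2)`. With `ε ≤ D / 2`, any `t` at distance `D` from `x` is at least `D - ε ≥ ε` from `ζ - i`.
  refine ⟨min (1 / 2) (min ((h ^ 2 - q ^ 2) / (2 * q + 2)) (D / 2)), by positivity, ?_⟩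
  set ε := min (1 / 2) (min ((h ^ 2 - q ^ 2) / (2 * q + 2)) (D / 2)) with hε
  have hε1 : ε ≤ 1 / 2 := min_le_left _ _
  have hε2 : ε ≤ (h ^ 2 - q ^ 2) / (2 * q + 2) := (min_le_right _ _).trans (min_le_left _ _)
  have hε3 : ε ≤ D / 2 := (min_le_right _ _).trans (min_le_right _ _)
  have hε0 : 0 < ε := by positivity
  intro ζ hζ
  rw [Metric.mem_closedBall, dist_eq_norm] at hζ
  have h1 : |ζ.re - x| ≤ ε := by
    simpa using (Complex.abs_re_le_norm _).trans hζ
  have h2 : |ζ.im - 1| ≤ ε := by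
    simpa using (Complex.abs_im_le_norm _).trans hζ
  rw [abs_le] at h2
  refine ⟨by linarith, ?_, ?_, ?_⟩
  · rw [abs_le]; constructor <;> linarith
  · rw [le_div_iff₀ (by linarith)] at hε2
    have h3 : |ζ.re - m| ≤ ε + q :=
      (abs_sub_le ζ.re x m).trans (add_le_add h1 le_rfl)
    have h4 : (ζ.re - m) ^ 2 ≤ (ε + q) ^ 2 := sq_le_sq' (by linarith [abs_le.1 h3]) (abs_le.1 h3).2
    have h5 : ζ.im - ζ.im ^ 2 ≤ ε := by nlinarith
    nlinarith
  · intro t ht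
    have h3 : |t - x| ≤ ‖(t : ℂ) - (ζ - Complex.I)‖ + ‖ζ - ((x : ℂ) + Complex.I)‖ := by
      have : ((t - x : ℝ) : ℂ) = ((t : ℂ) - (ζ - Complex.I)) + (ζ - ((x : ℂ) + Complex.I)) := by
        push_cast; ring
      rw [← Real.norm_eq_abs, ← Complex.norm_real, this]
      exact norm_add_le _ _
    linarith

/-- A strictly positive distance is needed even for radius `0`, and even if there are no
eigenvalues. -/
theorem exists_pos_le_of_finite {α : Type*} {s : Set α} (hs : s.Finite) {f : α → ℝ} {r : ℝ}
    (hr : 0 ≤ r) (h : ∀ t ∈ s, r ≤ f t ∧ 0 < f t) : ∃ D > 0, r ≤ D ∧ ∀ t ∈ s, D ≤ f t := by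
  rcases s.eq_empty_or_nonempty with rfl | hne
  · exact ⟨r + 1, by linarith, by linarith, by simp⟩
  · obtain ⟨t, ht, hmin⟩ := Set.exists_min_image s f hs hne
    exact ⟨f t, (h t ht).2, (h t ht).1, hmin⟩

end Regions

/-! ### Comparison with a block diagonal operator on a fixed circle -/

section CircleComparison

variable {H : Type*} [NormedAddCommGroup H] [InnerProductSpace ℂ H] [CompleteSpace H]
  {T : H →L[ℂ] H} {J : Set ℝ} {m h h₂ : ℝ}

theorem mem_resolventSet_add_smul {Q : H →L[ℂ] H} (hT : IsSelfAdjoint T)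
    [FiniteDimensional ℂ (LinearMap.range (Q : H →ₗ[ℂ] H))] {ζ : ℂ} (hζ : ζ.im ≠ 0) {C : ℝ}
    (hC : ∀ x, ‖x‖ ≤ C * ‖T x + Complex.I • Q x - ζ • x‖) :
    ζ ∈ resolventSet ℂ (T + Complex.I • Q) := by
  have : FiniteDimensional ℂ (LinearMap.range ((Complex.I • Q : H →L[ℂ] H) : H →ₗ[ℂ] H)) := by
    refine Submodule.finiteDimensional_of_le (S₂ := LinearMap.range (Q : H →ₗ[ℂ] H)) ?_
    rintro _ ⟨x, rfl⟩
    exact Submodule.smul_mem _ _ ⟨x, rfl⟩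
  refine mem_resolventSet_of_injective hT hζ fun x hx => ?_
  have h1 : T x + Complex.I • Q x - ζ • x = 0 := hx
  have h2 := hC x
  rw [h1, norm_zero, mul_zero] at h2
  exact norm_le_zero_iff.1 h2

/-- Since `1 - Q` is a projection, it can be inserted twice; this is the source of the square in
`r_n = O(δ_n²)`. -/
theorem ReducingGap.norm_mul_mul_le {E : H →L[ℂ] H} (G : ReducingGap T E m h h₂) {Q : H →L[ℂ] H}
    (hQ : IsSelfAdjoint Q) (hQ2 : Q * Q = Q) {g : ℝ} (hg : ‖(1 - Q) * E‖ ≤ g) :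
    ‖E * (1 - Q) * E‖ ≤ g ^ 2 := by
  have h1 : E * (1 - Q) * E = (E * (1 - Q)) * ((1 - Q) * E) := by
    have : (1 - Q) * (1 - Q) = 1 - Q := by
      rw [mul_sub, mul_one, sub_mul, one_mul, hQ2, sub_self, sub_zero]
    rw [mul_assoc E (1 - Q) E, mul_assoc E (1 - Q) ((1 - Q) * E), ← mul_assoc (1 - Q) (1 - Q) E,
      this]
  rw [h1, sq]
  refine (norm_mul_le _ _).trans (mul_le_mul ?_ hg (norm_nonneg _) ((norm_nonneg _).trans hg))
  rwa [G.norm_mul_compl_le (isEffect_of_projection hQ hQ2)]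

/-- Uniform bound on the inverse of `T + iQ - ζ` away from the points `t + i`, for `t` in the
spectrum of `T` in `J`. -/
theorem ReducingGap.norm_le_of_dist (G : ReducingGap T (specProj T J) m h h₂)
    (hJ : SpecClopen T J) {Q : H →L[ℂ] H} (hQ : IsSelfAdjoint Q) (hQ2 : Q * Q = Q) {ζ : ℂ}
    (hζ : (ζ.re - m) ^ 2 + ζ.im - ζ.im ^ 2 ≤ h ^ 2) (hy : |ζ.im| ≤ 2) {D : ℝ}
    (hD : ∀ t ∈ spectrum ℝ T, t ∈ J → D ≤ ‖(t : ℂ) - (ζ - Complex.I)‖)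
    {κ g d : ℝ} (hκ : κ = (h₂ ^ 2 - h ^ 2) / (2 * h₂ + 5)) (hg : ‖(1 - Q) * specProj T J‖ ≤ g)
    (hd : 0 < d) (hDd : g ^ 2 + g ^ 2 / κ + d ≤ D) (x : H) :
    ‖x‖ ≤ ((1 + g / κ) ^ 2 / d + κ⁻¹) * ‖T x + Complex.I • Q x - ζ • x‖ := by
  have hκ0 : 0 < κ := hκ ▸ G.kappa_pos
  have hD0 : 0 ≤ D := le_trans (by positivity) hDd
  refine G.norm_le (isEffect_of_projection hQ hQ2) hζ hy
    (le_norm_sub_smul_specProj G.isSelfAdjoint hJ hD0 hD) hκ hg hd ?_ x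
  have := G.norm_mul_mul_le hQ hQ2 hg
  linarith

/-- The comparison operator: the eigenvalue `x` is not shifted, and it has no spectrum near
`x + i`. -/
theorem ReducingGap.norm_le_comparison (G : ReducingGap T (specProj T J) m h h₂)
    (hJ : SpecClopen T J) {x : ℝ} (hxJ : x ∈ J) (hx : SpecClopen T {x})
    {Q : H →L[ℂ] H} (hQ : IsEffect Q) {ζ : ℂ}
    (hζ : (ζ.re - m) ^ 2 + ζ.im - ζ.im ^ 2 ≤ h ^ 2) (hy : |ζ.im| ≤ 2) (hy' : 1 / 2 ≤ ζ.im)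
    {ε : ℝ} (hε : 0 < ε)
    (hD : ∀ t ∈ spectrum ℝ T, t ≠ x → ε ≤ ‖(t : ℂ) - (ζ - Complex.I)‖)
    {κ : ℝ} (hκ : κ = (h₂ ^ 2 - h ^ 2) / (2 * h₂ + 5)) (v : H) :
    ‖v‖ ≤ (2 + ε⁻¹ + κ⁻¹) * ‖T v + Complex.I • ((specProj T J - specProj T {x}) +
      (1 - specProj T J) * Q * (1 - specProj T J)) v - ζ • v‖ := by
  have hκ0 : 0 < κ := hκ ▸ G.kappa_pos
  have hT := G.isSelfAdjoint
  have hsub : {x} ⊆ J := Set.singleton_subset_iff.2 hxJ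
  set E := specProj T J with hE
  set P := specProj T {x} with hP
  have hEP : ∀ y, E (P y) = P y := fun y =>
    congrArg (fun A : H →L[ℂ] H => A y) (specProj_mul_of_subset hJ hx hsub)
  have hPE : ∀ y, P (E y) = P y := fun y =>
    congrArg (fun A : H →L[ℂ] H => A y) (specProj_mul_of_superset hJ hx hsub)
  have hPP : ∀ y, P (P y) = P y := fun y =>
    congrArg (fun A : H →L[ℂ] H => A y) (specProj_mul_self hx)
  have hEE := G.apply_apply
  have hET := G.apply_map
  have hPT : ∀ y, P (T y) = T (P y) := fun y =>
    congrArg (fun A : H →L[ℂ] H => A y) (specProj_commute hT {x}).eq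
  have hTP : ∀ y, T (P y) = (x : ℂ) • P y := apply_specProj_singleton hT hx
  have hdiff : specProj T (J \ {x}) = E - P := specProj_diff hJ hx hsub
  set f := T v + Complex.I • ((E - P) + (1 - E) * Q * (1 - E)) v - ζ • v with hf
  -- The operator is reduced by `ran P`, `ran (E - P)` and `ker E`. On the first it is the real
  -- scalar `x`, at distance at least `1/2` from `ζ`; on the second it is `T + i`, without the
  -- eigenvalue `x`; on the third the gap bound applies.
  have h1 : ‖P v‖ ≤ 2 * ‖f‖ := by
    have e1 : P f = ((x : ℂ) - ζ) • P v := by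
      simp only [hf, map_add, map_sub, map_smul, add_apply, mul_apply_eq_comp, sub_apply,
        one_apply_eq_self, hPE, hPP, hPT, hTP]
      module
    have e2 := (isEffect_of_projection (isSelfAdjoint_specProj T {x})
      (specProj_mul_self hx)).norm_apply_le f
    have e3 : 1 / 2 ≤ ‖(x : ℂ) - ζ‖ := by
      refine le_trans ?_ (Complex.abs_im_le_norm _)
      rw [Complex.sub_im, Complex.ofReal_im, zero_sub, abs_neg]
      exact hy'.trans (le_abs_self _)
    rw [← hP, e1, norm_smul] at e2
    nlinarith [norm_nonneg (P v)]
  have h2 : ‖E v - P v‖ ≤ ε⁻¹ * ‖f‖ := by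
    have e1 : (E - P) f = T ((E - P) v) - (ζ - Complex.I) • (E - P) v := by
      simp only [hf, map_add, map_sub, map_smul, add_apply, mul_apply_eq_comp, sub_apply,
        one_apply_eq_self, hPE, hPP, hPT, hEP, hEE, hET]
      module
    have hdc := hJ.diff hx
    have e2 := (isEffect_of_projection (isSelfAdjoint_specProj T (J \ {x}))
      (specProj_mul_self hdc)).norm_apply_le f
    have e3 := le_norm_sub_smul_specProj hT hdc (ζ := ζ - Complex.I) hε.le
      (fun t ht htJ => hD t ht htJ.2) v
    rw [hdiff] at e2 e3
    rw [← e1] at e3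
    rw [inv_mul_eq_div, le_div_iff₀ hε, mul_comm]
    exact e3.trans e2
  have h3 : ‖v - E v‖ ≤ κ⁻¹ * ‖f‖ := by
    have e1 : f - E f =
        T (v - E v) + Complex.I • ((1 - E) * Q * (1 - E)) v - ζ • (v - E v) := by
      simp only [hf, map_add, map_sub, map_smul, add_apply, mul_apply_eq_comp, sub_apply,
        one_apply_eq_self, hEP, hEE, hET]
      module
    have e2 := G.compl_bound hQ hζ hy v
    rw [← hκ, ← e1] at e2
    rw [inv_mul_eq_div, le_div_iff₀ hκ0, mul_comm]
    exact e2.trans (G.norm_sub_apply_le f)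
  have h4 : v = P v + (E v - P v) + (v - E v) := by abel
  calc ‖v‖ = ‖P v + (E v - P v) + (v - E v)‖ := by rw [← h4]
    _ ≤ ‖P v‖ + ‖E v - P v‖ + ‖v - E v‖ := norm_add₃_le
    _ ≤ 2 * ‖f‖ + ε⁻¹ * ‖f‖ + κ⁻¹ * ‖f‖ := by linarith
    _ = _ := by ring

theorem finiteDimensional_range_comparison (hJ : SpecClopen T J) {x : ℝ} (hxJ : x ∈ J)
    (hx : SpecClopen T {x}) (Q : H →L[ℂ] H)
    [FiniteDimensional ℂ (LinearMap.range (Q : H →ₗ[ℂ] H))]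
    [FiniteDimensional ℂ (LinearMap.range (specProj T J : H →ₗ[ℂ] H))] :
    FiniteDimensional ℂ (LinearMap.range (((specProj T J - specProj T {x}) +
      (1 - specProj T J) * Q * (1 - specProj T J) : H →L[ℂ] H) : H →ₗ[ℂ] H)) := by
  refine Submodule.finiteDimensional_of_le (S₂ := LinearMap.range (Q : H →ₗ[ℂ] H) ⊔
    LinearMap.range (specProj T J : H →ₗ[ℂ] H)) ?_
  rintro _ ⟨v, rfl⟩
  have h1 : specProj T J (specProj T {x} v) = specProj T {x} v :=
    congrArg (fun A : H →L[ℂ] H => A v)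
      (specProj_mul_of_subset hJ hx (Set.singleton_subset_iff.2 hxJ))
  rw [Submodule.mem_sup]
  refine ⟨_, ⟨v - specProj T J v, rfl⟩, _, ⟨v - specProj T {x} v -
    Q (v - specProj T J v), rfl⟩, ?_⟩
  simp only [ContinuousLinearMap.coe_coe, map_sub, h1, add_apply, sub_apply, mul_apply_eq_comp,
    one_apply_eq_self]
  abel

/-- The radius is fixed, so the resolvent bounds `C₁` and `C₂` do not depend on `Q`, and the
distance of the projections is bounded by a multiple of `‖(1 - Q) E‖`. -/
theorem ReducingGap.exists_norm_rieszProjection_sub_lt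
    (G : ReducingGap T (specProj T J) m h h₂) (hJ : SpecClopen T J) {x : ℝ} (hxJ : x ∈ J)
    (hx : SpecClopen T {x}) [FiniteDimensional ℂ (LinearMap.range (specProj T J : H →ₗ[ℂ] H))]
    {ε : ℝ} (hε : 0 < ε)
    (hball : ∀ ζ ∈ Metric.closedBall ((x : ℂ) + Complex.I) ε,
      1 / 2 ≤ ζ.im ∧ |ζ.im| ≤ 2 ∧ (ζ.re - m) ^ 2 + ζ.im - ζ.im ^ 2 ≤ h ^ 2 ∧
      ∀ t ∈ spectrum ℝ T, t ≠ x → ε ≤ ‖(t : ℂ) - (ζ - Complex.I)‖) :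
    ∃ γ > 0, ∀ Q : H →L[ℂ] H, IsSelfAdjoint Q → Q * Q = Q →
      FiniteDimensional ℂ (LinearMap.range (Q : H →ₗ[ℂ] H)) → ‖(1 - Q) * specProj T J‖ ≤ γ →
      ‖rieszProjection (T + Complex.I • Q) ((x : ℂ) + Complex.I) ε - specProj T {x}‖ < 1 := by
  set E := specProj T J with hE
  set P := specProj T {x} with hP
  set c : ℂ := (x : ℂ) + Complex.I with hc
  set κ := (h₂ ^ 2 - h ^ 2) / (2 * h₂ + 5) with hκ
  have hκ0 : 0 < κ := G.kappa_pos
  -- Chosen so that `γ₀² (1 + κ⁻¹) ≤ ε / 2`, which leaves `d = ε / 2` in the lower bound on the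
  -- circle.
  set γ₀ := min 1 (ε / 2 / (1 + κ⁻¹)) with hγ₀
  have hγ₀0 : 0 < γ₀ := by positivity
  set C₁ := (1 + γ₀ / κ) ^ 2 / (ε / 2) + κ⁻¹ with hC₁
  set C₂ := 2 + ε⁻¹ + κ⁻¹ with hC₂
  set X := ε * (C₁ * 3 * (ε⁻¹ + C₂ * 2)) with hX
  have hX0 : 0 < X := by positivity
  refine ⟨min γ₀ (1 / (2 * X)), by positivity, fun Q hQ hQ2 hQfin hg => ?_⟩
  set γ := min γ₀ (1 / (2 * X)) with hγ
  have hQe := isEffect_of_projection hQ hQ2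
  have hsum : γ₀ ^ 2 + γ₀ ^ 2 / κ + ε / 2 ≤ ε := by
    have h1 : γ₀ ≤ 1 := min_le_left _ _
    have h2 : γ₀ ≤ ε / 2 / (1 + κ⁻¹) := min_le_right _ _
    rw [le_div_iff₀ (by positivity)] at h2
    have h3 : γ₀ ^ 2 ≤ γ₀ := by nlinarith
    have h4 : γ₀ ^ 2 * (1 + κ⁻¹) ≤ γ₀ * (1 + κ⁻¹) :=
      mul_le_mul_of_nonneg_right h3 (by positivity)
    have h5 : γ₀ ^ 2 + γ₀ ^ 2 / κ = γ₀ ^ 2 * (1 + κ⁻¹) := by ring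
    linarith
  have hAbd : ∀ ζ ∈ Metric.sphere c ε, ∀ y,
      ‖y‖ ≤ C₁ * ‖T y + Complex.I • Q y - ζ • y‖ := by
    intro ζ hζ
    obtain ⟨h1, h2, h3, h4⟩ := hball ζ (Metric.sphere_subset_closedBall hζ)
    refine G.norm_le_of_dist hJ hQ hQ2 h3 h2 (D := ε) (fun t ht _ => ?_) hκ
      (hg.trans (min_le_left _ _)) (by positivity) hsum
    by_cases htx : t = x
    · have : (t : ℂ) - (ζ - Complex.I) = c - ζ := by rw [htx, hc]; ring
      rw [this, ← dist_eq_norm, dist_comm, Metric.mem_sphere.1 hζ]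
    · exact h4 t ht htx
  set F : H →L[ℂ] H := (E - P) + (1 - E) * Q * (1 - E) with hF
  have hFfin : FiniteDimensional ℂ (LinearMap.range (F : H →ₗ[ℂ] H)) :=
    finiteDimensional_range_comparison hJ hxJ hx Q
  have hBbd : ∀ ζ ∈ Metric.closedBall c ε, ∀ y,
      ‖y‖ ≤ C₂ * ‖T y + Complex.I • F y - ζ • y‖ := by
    intro ζ hζ
    obtain ⟨h1, h2, h3, h4⟩ := hball ζ hζ
    exact G.norm_le_comparison hJ hxJ hx hQe h3 h2 h1 hε h4 hκ
  have hArs : Metric.sphere c ε ⊆ resolventSet ℂ (T + Complex.I • Q) := fun ζ hζ =>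
    mem_resolventSet_add_smul G.isSelfAdjoint
      (by have := (hball ζ (Metric.sphere_subset_closedBall hζ)).1; linarith) (hAbd ζ hζ)
  have hBrs : Metric.closedBall c ε ⊆ resolventSet ℂ (T + Complex.I • F) := fun ζ hζ =>
    mem_resolventSet_add_smul G.isSelfAdjoint
      (by have := (hball ζ hζ).1; linarith) (hBbd ζ hζ)
  have hsub : {x} ⊆ J := Set.singleton_subset_iff.2 hxJ
  have hPP : P * P = P := specProj_mul_self hx
  have hEP : E * P = P := specProj_mul_of_subset hJ hx hsub
  have hPE : P * E = P := specProj_mul_of_superset hJ hx hsub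
  have hPF : P * F = 0 := by
    have h1 : P * (1 - E) = 0 := by rw [mul_sub, hPE, mul_one, sub_self]
    rw [hF, mul_add, mul_sub, hPE, hPP, ← mul_assoc, ← mul_assoc, h1, zero_mul, zero_mul,
      sub_self, add_zero]
  have hFP : F * P = 0 := by
    have h1 : (1 - E) * P = 0 := by rw [sub_mul, hEP, one_mul, sub_self]
    rw [hF, add_mul, sub_mul, hEP, hPP, mul_assoc _ _ P, h1, mul_zero, sub_self, add_zero]
  -- What is dropped is `E(1 - Q)E - (1 - Q)E - E(1 - Q)`, three terms of norm at most `γ`.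
  have hη : ‖T + Complex.I • Q - (T + Complex.I • F + Complex.I • P)‖ ≤ 3 * γ := by
    have h1 : T + Complex.I • Q - (T + Complex.I • F + Complex.I • P) =
        Complex.I • (E * ((1 - Q) * E) - (1 - Q) * E - E * (1 - Q)) := by
      rw [add_assoc, add_sub_add_left_eq_sub, ← smul_add, ← smul_sub, hF]
      congr 1
      have : E * E = E := G.proj_mul_self
      simp only [mul_sub, sub_mul, mul_one, one_mul, this, mul_assoc]
      abel
    have h2 : ‖E * ((1 - Q) * E)‖ ≤ 1 * γ := (norm_mul_le _ _).trans
      (mul_le_mul (isEffect_of_projection G.isSelfAdjoint_proj G.proj_mul_self).norm_le_one hg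
        (norm_nonneg _) zero_le_one)
    have h3 : ‖E * (1 - Q)‖ ≤ γ := by rwa [G.norm_mul_compl_le hQe]
    rw [h1, norm_smul, Complex.norm_I, one_mul]
    refine (norm_sub_le _ _).trans ?_
    have h4 := norm_sub_le (E * ((1 - Q) * E)) ((1 - Q) * E)
    linarith
  have hTP : T * P = (x : ℂ) • P := by
    ext v
    exact apply_specProj_singleton G.isSelfAdjoint hx v
  have key := norm_rieszProjection_sub_le (C₁ := C₁) (C₂ := C₂) hε hArs hBrs
    (fun ζ hζ => ContinuousLinearMap.opNorm_le_bound _ (by positivity)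
      (norm_resolvent_apply_le (hArs hζ) (hAbd ζ hζ)))
    (fun ζ hζ => ContinuousLinearMap.opNorm_le_bound _ (by positivity)
      (norm_resolvent_apply_le (hBrs (Metric.sphere_subset_closedBall hζ))
        (hBbd ζ (Metric.sphere_subset_closedBall hζ))))
    hPP (isEffect_of_projection (isSelfAdjoint_specProj T {x}) hPP).norm_le_one
    (by
      rw [Commute, SemiconjBy, mul_add, add_mul, mul_smul_comm, smul_mul_assoc, hPF, hFP,
        (specProj_commute G.isSelfAdjoint {x}).eq])
    (by
      rw [add_mul, smul_mul_assoc, hFP, smul_zero, add_zero, hTP, hc, add_sub_cancel_right])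
    hη
  refine key.trans_lt ?_
  have h1 : γ ≤ 1 / (2 * X) := min_le_right _ _
  rw [le_div_iff₀ (by positivity)] at h1
  have h2 : ε * (C₁ * (3 * γ) * (ε⁻¹ + C₂ * 2)) = γ * X := by rw [hX]; ring
  rw [h2]
  linarith

end CircleComparison

/-! ### Assembly of the estimates -/

section Main

variable {H : Type*} [NormedAddCommGroup H] [InnerProductSpace ℂ H] [CompleteSpace H]
  {T : H →L[ℂ] H}

theorem exists_reducingGap (hT : IsSelfAdjoint T) {a b : ℝ} (hab : a < b)
    (ha : (a : ℂ) ∈ resolventSet ℂ T) (hb : (b : ℂ) ∈ resolventSet ℂ T)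
    (hJ : ∀ x ∈ Set.Icc a b, SpecClopen T {x}) :
    ∃ h' h₂ : ℝ, 0 ≤ h' ∧ h' < (b - a) / 2 ∧
      (∀ t ∈ spectrum ℝ T, t ∈ Set.Icc a b → |t - (a + b) / 2| ≤ h') ∧
      ReducingGap T (specProj T (Set.Icc a b)) ((a + b) / 2) ((b - a) / 2) h₂ := by
  obtain ⟨Da, hDa, hgapa⟩ := (hJ a (Set.left_mem_Icc.2 hab.le)).exists_gap
  obtain ⟨Db, hDb, hgapb⟩ := (hJ b (Set.right_mem_Icc.2 hab.le)).exists_gap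
  have hgap : ∀ t ∈ spectrum ℝ T, Da ≤ |t - a| ∧ Db ≤ |t - b| := by
    intro t ht
    refine ⟨hgapa t ht ?_, hgapb t ht ?_⟩
    · rintro rfl
      exact (ofReal_mem_spectrum_iff T _).2 ht ha
    · rintro rfl
      exact (ofReal_mem_spectrum_iff T _).2 ht hb
  have hclopen := specClopen_of_finite (finite_spectrum_inter_Icc hJ) hJ
  -- A margin free of spectrum on both sides of `a` and of `b`; the last entry keeps `h' = (b - a) /
  -- 2 - η` nonnegative.
  set η := min (min Da Db) ((b - a) / 2) with hη
  have hη0 : 0 < η := lt_min (lt_min hDa hDb) (by linarith)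
  have hηa : η ≤ Da := (min_le_left _ _).trans (min_le_left _ _)
  have hηb : η ≤ Db := (min_le_left _ _).trans (min_le_right _ _)
  have hηh : η ≤ (b - a) / 2 := min_le_right _ _
  refine ⟨(b - a) / 2 - η, (b - a) / 2 + η, by linarith, by linarith, ?_, ?_⟩
  · intro t ht htJ
    obtain ⟨h1, h2⟩ := hgap t ht
    rw [abs_of_nonneg (sub_nonneg.2 htJ.1)] at h1
    rw [abs_of_nonpos (sub_nonpos.2 htJ.2)] at h2
    rw [abs_le]
    constructor <;> linarith
  · refine ⟨hT, isSelfAdjoint_specProj _ _, specProj_mul_self hclopen, specProj_commute hT _,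
      by linarith, by linarith, fun x => ?_⟩
    have h1 := le_norm_sub_smul_specProj hT hclopen.compl (ζ := (((a + b) / 2 : ℝ) : ℂ))
      (D := (b - a) / 2 + η) (by linarith) (fun t ht htJ => by
        rw [← Complex.ofReal_sub, Complex.norm_real, Real.norm_eq_abs]
        obtain ⟨h1, h2⟩ := hgap t ht
        rcases lt_or_ge t a with hta | hta
        · rw [abs_of_nonpos (by linarith)] at h1
          exact le_trans (by linarith) (neg_le_abs _)
        · have htb : b < t := by
            by_contra hle
            exact htJ ⟨hta, not_lt.1 hle⟩
          rw [abs_of_nonneg (by linarith)] at h2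
          exact le_trans (by linarith) (le_abs_self _)) x
    rw [specProj_compl hT hclopen] at h1
    exact h1

theorem ReducingGap.mem_resolventSet {J : Set ℝ} {m h h₂ : ℝ}
    (G : ReducingGap T (specProj T J) m h h₂) (hJ : SpecClopen T J) {Q : H →L[ℂ] H}
    (hQ : IsSelfAdjoint Q) (hQ2 : Q * Q = Q)
    [FiniteDimensional ℂ (LinearMap.range (Q : H →ₗ[ℂ] H))] {C δ κ : ℝ}
    (hκ : κ = (h₂ ^ 2 - h ^ 2) / (2 * h₂ + 5)) (hg : ‖(1 - Q) * specProj T J‖ ≤ C * δ)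
    {ζ : ℂ} (hζ0 : ζ.im ≠ 0) (hζ : (ζ.re - m) ^ 2 + ζ.im - ζ.im ^ 2 ≤ h ^ 2)
    (hy : |ζ.im| ≤ 2) {D : ℝ} (hD0 : 0 < D) (hDδ : (C ^ 2 * (1 + κ⁻¹) + 1) * δ ^ 2 ≤ D)
    (hD : ∀ t ∈ spectrum ℝ T, t ∈ J → D ≤ ‖(t : ℂ) - (ζ - Complex.I)‖) :
    ζ ∈ resolventSet ℂ (T + Complex.I • Q) := by
  refine mem_resolventSet_add_smul G.isSelfAdjoint hζ0
    (G.norm_le_of_dist hJ hQ hQ2 hζ hy hD hκ hg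
      -- Positive by the extra `+ 1` in `hDδ` if `δ ≠ 0`, and by `hD0` if `δ = 0`.
      (d := D - C ^ 2 * (1 + κ⁻¹) * δ ^ 2) ?_ (le_of_eq (by ring)))
  rcases eq_or_ne δ 0 with rfl | hδ
  · simpa using hD0
  · have : 0 < δ ^ 2 := by positivity
    linarith

/-- The circle of radius `ρ` about `x + i` encloses exactly the spectrum of `T + iQ` that
corresponds to the eigenvalue `x` of `T`, if `ρ` is below a fixed radius and not too small compared
to the distance from `ran E` to `ran Q`. -/
theorem ReducingGap.exists_circleEncloses {J : Set ℝ} {m h h₂ : ℝ}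
    (G : ReducingGap T (specProj T J) m h h₂) (hJ : SpecClopen T J) {x : ℝ} (hxJ : x ∈ J)
    (hx : SpecClopen T {x}) (hxm : |x - m| < h)
    [FiniteDimensional ℂ (LinearMap.range (specProj T J : H →ₗ[ℂ] H))] {κ : ℝ}
    (hκ : κ = (h₂ ^ 2 - h ^ 2) / (2 * h₂ + 5)) :
    ∃ ε > 0, ∃ γ > 0, ∀ (Q : H →L[ℂ] H) (C δ ρ : ℝ), IsSelfAdjoint Q → Q * Q = Q →
      FiniteDimensional ℂ (LinearMap.range (Q : H →ₗ[ℂ] H)) →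
      ‖(1 - Q) * specProj T J‖ ≤ C * δ → C * δ ≤ γ → 0 < ρ → ρ < ε →
      (C ^ 2 * (1 + κ⁻¹) + 1) * δ ^ 2 ≤ ρ →
      CircleEncloses (T + Complex.I • Q) ((x : ℂ) + Complex.I) ρ
        (Module.finrank ℂ (eigenspaceSpan T {x})) := by
  obtain ⟨D, hD, hgap⟩ := hx.exists_gap
  obtain ⟨ε, hε, hball⟩ := exists_radius hxm hD
  have hball' : ∀ ζ ∈ Metric.closedBall ((x : ℂ) + Complex.I) ε,
      1 / 2 ≤ ζ.im ∧ |ζ.im| ≤ 2 ∧ (ζ.re - m) ^ 2 + ζ.im - ζ.im ^ 2 ≤ h ^ 2 ∧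
      ∀ t ∈ spectrum ℝ T, t ≠ x → ε ≤ ‖(t : ℂ) - (ζ - Complex.I)‖ := fun ζ hζ =>
    ⟨(hball ζ hζ).1, (hball ζ hζ).2.1, (hball ζ hζ).2.2.1,
      fun t ht htx => (hball ζ hζ).2.2.2 t (hgap t ht htx)⟩
  obtain ⟨γ, hγ, hclose⟩ := G.exists_norm_rieszProjection_sub_lt hJ hxJ hx hε hball'
  refine ⟨ε, hε, γ, hγ, fun Q C δ ρ hQ hQ2 hQfin hg hgγ hρ hρε hδρ => ?_⟩
  have hann : Metric.closedBall ((x : ℂ) + Complex.I) ε \ Metric.ball ((x : ℂ) + Complex.I) ρ ⊆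
      resolventSet ℂ (T + Complex.I • Q) := by
    rintro ζ ⟨hζ1, hζ2⟩
    obtain ⟨h1, h2, h3, h4⟩ := hball' ζ hζ1
    refine G.mem_resolventSet hJ hQ hQ2 hκ hg (by linarith) h3 h2 hρ hδρ fun t ht _ => ?_
    by_cases htx : t = x
    · have : (t : ℂ) - (ζ - Complex.I) = ((x : ℂ) + Complex.I) - ζ := by rw [htx]; ring
      rw [this, ← dist_eq_norm, dist_comm]
      exact not_lt.1 hζ2
    · exact hρε.le.trans (h4 t ht htx)
  have hrange : LinearMap.range (specProj T {x} : H →ₗ[ℂ] H) = eigenspaceSpan T {x} := by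
    rw [range_specProj_singleton G.isSelfAdjoint hx, eigenspaceSpan, iSup_singleton]
  have hfin : FiniteDimensional ℂ (LinearMap.range (specProj T {x} : H →ₗ[ℂ] H)) := by
    refine Submodule.finiteDimensional_of_le (S₂ := LinearMap.range (specProj T J : H →ₗ[ℂ] H)) ?_
    rintro _ ⟨v, rfl⟩
    exact ⟨specProj T {x} v, congrArg (fun A : H →L[ℂ] H => A v)
      (specProj_mul_of_subset hJ hx (Set.singleton_subset_iff.2 hxJ))⟩
  refine ⟨fun ζ hζ => hann ⟨?_, ?_⟩, ?_⟩
  · rw [Metric.mem_closedBall, Metric.mem_sphere.1 hζ]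
    exact hρε.le
  · rw [Metric.mem_ball, Metric.mem_sphere.1 hζ]
    exact lt_irrefl _
  -- Ranks are compared on the circle of radius `ε`: the bound on the inverse degenerates as `ρ`
  -- shrinks, so a direct comparison at radius `ρ` could fail.
  · rw [← rieszProjection_eq_of_annulus hρ hρε.le hann, ← hrange]
    exact finrank_range_eq_of_norm_sub_lt_one (rieszProjection_mul_self hρ hρε hann)
      (specProj_mul_self hx) (hclose Q hQ hQ2 hQfin (hg.trans hgγ))

end Main

theorem theorem3p6 {H : Type*} [NormedAddCommGroup H] [InnerProductSpace ℂ H] [CompleteSpace H]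
    (T : H →L[ℂ] H) (hT : IsSelfAdjoint T)
    (a b : ℝ) (hab : a < b)
    (ha : (a : ℂ) ∈ resolventSet ℂ T) (hb : (b : ℂ) ∈ resolventSet ℂ T)
    (hdis : ∀ x ∈ Set.Icc a b, (x : ℂ) ∈ spectrum ℂ T → (x : ℂ) ∈ discreteSpectrum T)
    (L : ℕ → Submodule ℂ H) [∀ n, FiniteDimensional ℂ (L n)]
    (hL : ∀ φ : H, ∃ u : ℕ → H, (∀ n, u n ∈ L n) ∧ Tendsto u atTop (𝓝 φ)) :
    ∃ τ r : ℕ → ℝ,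
      (∀ n, 0 ≤ τ n) ∧ (∀ n, 0 ≤ r n) ∧
      τ =O[atTop] (fun n => subspaceGap (eigenspaceSpan T (Set.Icc a b)) (L n)) ∧
      r =O[atTop] (fun n => subspaceGap (eigenspaceSpan T (Set.Icc a b)) (L n) ^ 2) ∧
      ∀ᶠ n in atTop,
        galerkinRegion T a b (τ n) (r n) \ {z : ℂ | z.im = 0} ⊆
          resolventSet ℂ (T + Complex.I • galerkinProjection T (L n) (Set.Icc a b)) ∧
        ∀ x ∈ Set.Icc a b, (x : ℂ) ∈ spectrum ℂ T →
          (subspaceGap (eigenspaceSpan T (Set.Icc a b)) (L n) ≠ 0 →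
            CircleEncloses (T + Complex.I • galerkinProjection T (L n) (Set.Icc a b))
              ((x : ℂ) + Complex.I) (r n) (Module.finrank ℂ (eigenspaceSpan T {x}))) ∧
          (subspaceGap (eigenspaceSpan T (Set.Icc a b)) (L n) = 0 →
            ∀ᶠ ρ in 𝓝[>] (0 : ℝ),
              CircleEncloses (T + Complex.I • galerkinProjection T (L n) (Set.Icc a b))
                ((x : ℂ) + Complex.I) ρ (Module.finrank ℂ (eigenspaceSpan T {x}))) := by
  have hJ : ∀ x ∈ Set.Icc a b, SpecClopen T {x} := fun x hx =>
    specClopen_singleton_of_mem_discreteSpectrum (hdis x hx)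
  have hfin := finite_spectrum_inter_Icc hJ
  have hclopen := specClopen_of_finite hfin hJ
  obtain ⟨h', h₂, hh'0, hh', hspec, G⟩ := exists_reducingGap hT hab ha hb hJ
  have hrange := range_specProj hT hfin hJ
  have hEfin : FiniteDimensional ℂ
      (LinearMap.range (specProj T (Set.Icc a b) : H →ₗ[ℂ] H)) :=
    finiteDimensional_range_specProj hT hfin hJ fun x hx hxs =>
      (hdis x hx ((ofReal_mem_spectrum_iff T x).2 hxs)).2.2.2
  have hMfin : FiniteDimensional ℂ (eigenspaceSpan T (Set.Icc a b)) := hrange ▸ hEfin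
  set M := eigenspaceSpan T (Set.Icc a b) with hM
  set J := Set.Icc a b with hJdef
  set δ : ℕ → ℝ := fun n => subspaceGap M (L n) with hδ
  have hδ0 : ∀ n, 0 ≤ δ n := fun n => subspaceGap_nonneg _ _
  have hδlim : Tendsto δ atTop (𝓝 0) := tendsto_subspaceGap hL
  set h := (b - a) / 2 with hh
  set C := 1 + ‖T‖ / (h - h') with hC
  set κ := (h₂ ^ 2 - h ^ 2) / (2 * h₂ + 5) with hκ
  have hκ0 : 0 < κ := G.kappa_pos
  set K := C ^ 2 * (1 + κ⁻¹) + 1 with hK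
  have hK0 : 0 < K := by positivity
  set Q : ℕ → H →L[ℂ] H := fun n => galerkinProjection T (L n) J with hQdef
  have hQ : ∀ n, IsSelfAdjoint (Q n) := fun n => isSelfAdjoint_galerkinProjection _ _ _
  have hQ2 : ∀ n, Q n * Q n = Q n := fun n => galerkinProjection_mul_self _ _ _
  have hQfin : ∀ n, FiniteDimensional ℂ (LinearMap.range (Q n : H →ₗ[ℂ] H)) := fun n =>
    finiteDimensional_range_galerkinProjection _ _ _
  have hg : ∀ n, ‖(1 - Q n) * specProj T J‖ ≤ C * δ n := by
    intro n
    refine norm_one_sub_galerkinProjection_mul_le hT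
      (isEffect_of_projection G.isSelfAdjoint_proj G.proj_mul_self) G.proj_mul_self G.commute (L n)
      (m := (a + b) / 2) hh'0 hh' ?_ (norm_sub_smul_specProj_le hT hclopen hh'0 hspec) (hδ0 n) ?_
    · intro t ht
      rcases lt_or_ge t a with hta | hta
      · exact le_trans (by linarith) (neg_le_abs _)
      · have htb : b < t := by
          by_contra hle
          exact ht ⟨hta, not_lt.1 hle⟩
        exact le_trans (by linarith) (le_abs_self _)
    · intro x
      exact norm_sub_starProjection_le_gap (hrange ▸ ⟨x, rfl⟩)
  have hcircle : ∀ᶠ n in atTop, ∀ x ∈ spectrum ℝ T ∩ J, ∃ ε > 0, K * δ n ^ 2 < ε ∧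
      ∀ ρ, 0 < ρ → ρ < ε → K * δ n ^ 2 ≤ ρ →
        CircleEncloses (T + Complex.I • Q n) ((x : ℂ) + Complex.I) ρ
          (Module.finrank ℂ (eigenspaceSpan T {x})) := by
    -- Only finitely many eigenvalues occur, so each may have its own threshold in `n`.
    rw [eventually_all_finite hfin]
    rintro x ⟨hxs, hxJ⟩
    obtain ⟨ε, hε, γ, hγ, henc⟩ := G.exists_circleEncloses hclopen hxJ (hJ x hxJ)
      ((hspec x hxs hxJ).trans_lt hh') hκ
    have h1 : ∀ᶠ n in atTop, C * δ n < γ := by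
      have : Tendsto (fun n => C * δ n) atTop (𝓝 (C * 0)) := hδlim.const_mul C
      rw [mul_zero] at this
      exact this.eventually (gt_mem_nhds hγ)
    have h2 : ∀ᶠ n in atTop, K * δ n ^ 2 < ε := by
      have : Tendsto (fun n => K * δ n ^ 2) atTop (𝓝 (K * 0 ^ 2)) := (hδlim.pow 2).const_mul K
      rw [zero_pow two_ne_zero, mul_zero] at this
      exact this.eventually (gt_mem_nhds hε)
    filter_upwards [h1, h2] with n hn1 hn2
    exact ⟨ε, hε, hn2, fun ρ hρ hρε hKρ =>
      henc (Q n) C (δ n) ρ (hQ n) (hQ2 n) (hQfin n) (hg n) hn1.le hρ hρε hKρ⟩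
  -- Only `τ_n ≥ 0` is used, so `0` would serve as well as `δ_n`; the radius `K δ_n²` is the
  -- smallest that the lower bound covers.
  refine ⟨δ, fun n => K * δ n ^ 2, hδ0, fun n => by positivity, isBigO_refl _ _,
    (isBigO_refl _ _).const_mul_left K, ?_⟩
  filter_upwards [hcircle] with n hn
  refine ⟨?_, fun x hxJ hxs => ?_⟩
  · rintro z ⟨⟨hz1, hz2, hz3, hz4, hz5, hz6, hz7⟩, hz0⟩
    have hδn := hδ0 n
    obtain ⟨D, hD0, hD1, hD2⟩ := exists_pos_le_of_finite hfin
      (f := fun t : ℝ => ‖(t : ℂ) - (z - Complex.I)‖) (r := K * δ n ^ 2) (by positivity)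
      (fun t ht => by
        obtain ⟨h1, h2⟩ := hz7 t ht.2 ((ofReal_mem_spectrum_iff T t).2 ht.1)
        have h3 : (t : ℂ) - (z - Complex.I) = -(z - ((t : ℂ) + Complex.I)) := by ring
        rw [h3, norm_neg]
        exact ⟨h1, norm_pos_iff.2 (sub_ne_zero.2 h2)⟩)
    refine G.mem_resolventSet hclopen (hQ n) (hQ2 n) hκ (hg n) hz0
      (re_im_bound_of_region hz1 hz2 hz3 hz4 (by linarith) (by linarith)) ?_ hD0 hD1
      fun t ht htJ => hD2 t ⟨ht, htJ⟩
    rw [abs_of_nonneg hz3]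
    linarith
  · obtain ⟨ε, hε, hKε, henc⟩ := hn x ⟨(ofReal_mem_spectrum_iff T x).1 hxs, hxJ⟩
    refine ⟨fun hne => henc _ ?_ hKε le_rfl, fun h0 => ?_⟩
    · have : δ n ≠ 0 := hne
      positivity
    · filter_upwards [Ioo_mem_nhdsGT hε] with ρ hρ
      refine henc ρ hρ.1 hρ.2 ?_
      have : δ n = 0 := h0
      rw [this]
      simpa using hρ.1.le
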